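/- Let $n\ge 1$, $\alpha\in(1/2,1)$, $\varrho>0$, and let $W:[-\varrho,\varrho]\times\mathbb R^n\to\mathbb R$ be of class $C^1$. Write $\nabla W(t,u)$ for the gradient of $W$ with respect to $u$ and $H(t,u)=\tfrac12\langle\nabla W(t,u),u\rangle-W(t,u)$. Suppose that: - $(W_1)$ $|\nabla W(t,u)|=o(|u|)$ as $|u|\to0$, uniformly in $t\in[-\varrho,\varrho]$; - $(W_2)$ $W(t,u)\ge0$ and $H(t,u)\ge0$ for all $(t,u)\in[-\varrho,\varrho]\times\mathbb R^n$; - $(W_3)$ $W(t,u)/|u|^2\to+\infty$ as $|u|\to+\infty$, uniformly in $t\in[-\varrho,\varrho]$; - $(W_4)$ there are $C_0,R>0$ and $\sigma>1$ such that $|\nabla W(t,u)|^\sigma/|u|^\sigma\le C_0H(t,u)$ for all $t\in[-\varrho,\varrho]$ and $|u|\ge R$. Let ${}_{-\varrho}D_t^\alpha u(t)=\frac{d}{dt}\,\frac1{\Gamma(1-\alpha)}\int_{-\varrho}^t(t-s)^{-\alpha}u(s)\,ds$ and ${}_tD_\varrho^\alpha u(t)=-\frac{d}{dt}\,\frac1{\Gamma(1-\alpha)}\int_t^{\varrho}(s-t)^{-\alpha}u(s)\,ds$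 be the left and right Riemann–Liouville derivatives on $[-\varrho,\varrho]$, and let $E_0^\alpha$ be the closure of $C_0^\infty((-\varrho,\varrho),\mathbb R^n)$ with respect to the norm $\left(\int_{-\varrho}^{\varrho}|u|^2dt+\int_{-\varrho}^{\varrho}|{}_{-\varrho}D_t^\alpha u|^2dt\right)^{1/2}$. Then the boundary value problem $${}_tD_\varrho^\alpha\left({}_{-\varrho}D_t^\alpha u\right)=\nabla W(t,u)\ \text{ on }(-\varrho,\varrho),\qquad u(-\varrho)=u(\varrho)=0,$$ has at least one nontrivial weak solution, that is, there is $u\in E_0^\alpha$, $u\ne0$, continuous on $[-\varrho,\varrho]$ with $u(\pm\varrho)=0$, such that $$\int_{-\varrho}^{\varrho}\langle{}_{-\varrho}D_t^\alpha u(t),{}_{-\varrho}D_t^\alpha v(t)\rangle\,dt=\int_{-\varrho}^{\varrho}\langle\nabla W(t,u(t)),v(t)\rangle\,dt\qquad\text{for all }v\in E_0^\alpha,$$ all these integrals being convergent. -/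

import Mathlib

open MeasureTheory Set Filter Topology
open scoped ENNReal ContDiff

noncomputable section

namespace FracBVP

/-- The left Riemann-Liouville fractional integral of order `γ > 0` with base point `a`,
`(1 / Γ(γ)) ∫_a^t (t - s)^(γ - 1) u(s) ds`. -/
def rlIntegral {n : ℕ} (a γ : ℝ) (u : ℝ → EuclideanSpace ℝ (Fin n)) (t : ℝ) :
    EuclideanSpace ℝ (Fin n) :=
  (1 / Real.Gamma γ) • ∫ s in a..t, (t - s) ^ (γ - 1) • u s

/-- The left Riemann-Liouville fractional derivative of order `α`, for `0 < α < 1`, with base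
point `a`: the derivative of the fractional integral of order `1 - α`. It is used almost
everywhere on an interval `[a, b]`. -/
def rlDeriv {n : ℕ} (a α : ℝ) (u : ℝ → EuclideanSpace ℝ (Fin n)) (t : ℝ) :
    EuclideanSpace ℝ (Fin n) :=
  deriv (rlIntegral a (1 - α) u) t

/-- Smooth functions with compact support inside the open interval `(a, b)`. -/
def IsTestFunction {n : ℕ} (a b : ℝ) (φ : ℝ → EuclideanSpace ℝ (Fin n)) : Prop :=
  ContDiff ℝ ∞ φ ∧ tsupport φ ⊆ Ioo a b

/-- Membership in the fractional derivative space `E_0^α = E_0^{α,2}` on `[a, b]`, the closure of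
the test functions with respect to the norm
`(∫_a^b |u|² + ∫_a^b |D^α u|²)^(1/2)`, where `D^α` is the left Riemann-Liouville derivative with
base point `a`. Elements are represented by functions on the line, of which only the values at
almost every point of `[a, b]` matter. -/
def MemE0 {n : ℕ} (a b α : ℝ) (u : ℝ → EuclideanSpace ℝ (Fin n)) : Prop :=
  MemLp u 2 (volume.restrict (Icc a b)) ∧
  MemLp (rlDeriv a α u) 2 (volume.restrict (Icc a b)) ∧
  ∃ φ : ℕ → ℝ → EuclideanSpace ℝ (Fin n),
    (∀ k, IsTestFunction a b (φ k)) ∧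
    Tendsto (fun k => eLpNorm (fun t => φ k t - u t) 2 (volume.restrict (Icc a b)))
      atTop (𝓝 0) ∧
    Tendsto (fun k => eLpNorm (fun t => rlDeriv a α (φ k) t - rlDeriv a α u t) 2
      (volume.restrict (Icc a b))) atTop (𝓝 0)

/-- The function `H(t, u) = ⟨∇W(t, u), u⟩ / 2 - W(t, u)`, with the gradient taken in `u`. -/
def H {n : ℕ} (W : ℝ → EuclideanSpace ℝ (Fin n) → ℝ) (t : ℝ) (x : EuclideanSpace ℝ (Fin n)) : ℝ :=
  (1 / 2) * inner ℝ (gradient (W t) x) x - W t x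

/-- Weak solutions of the Dirichlet problem
`_tD^α_b (_aD^α_t u) = ∇W(t, u)` on `(a, b)`, `u(a) = u(b) = 0`:
the (continuous representative of an) element `u` of `E_0^α` such that
`∫_a^b ⟨D^α u, D^α v⟩ = ∫_a^b ⟨∇W(t, u), v⟩` for all `v` in `E_0^α`, all integrals being
convergent. -/
def IsWeakSolution {n : ℕ} (a b α : ℝ) (W : ℝ → EuclideanSpace ℝ (Fin n) → ℝ)
    (u : ℝ → EuclideanSpace ℝ (Fin n)) : Prop :=
  MemE0 a b α u ∧ ContinuousOn u (Icc a b) ∧ u a = 0 ∧ u b = 0 ∧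
  ∀ v : ℝ → EuclideanSpace ℝ (Fin n), MemE0 a b α v →
    IntegrableOn (fun t => inner ℝ (rlDeriv a α u t) (rlDeriv a α v t)) (Icc a b) ∧
    IntegrableOn (fun t => inner ℝ (gradient (W t) (u t)) (v t)) (Icc a b) ∧
    ∫ t in Icc a b, inner ℝ (rlDeriv a α u t) (rlDeriv a α v t) =
      ∫ t in Icc a b, inner ℝ (gradient (W t) (u t)) (v t)

end FracBVP

end

set_option linter.unusedSectionVars false

noncomputable section

namespace FracBVP

/-! Take the fractional derivative `g` of `u` as the unknown, so that `u = K g` with `K` the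
Riemann-Liouville integral of order `α`. Since `I^(1-α) I^α` is ordinary integration, `K` is
injective with left inverse `rlDeriv`, and `MemE0` corresponds to the closure in L² of the space
`testDerivs` (`memE0_rlIntegral`, `MemE0.exists_rlOperator`). The weak equation becomes `⟨g, h⟩ = ∫
⟨∇W(t, K g), K h⟩` for all `h` in that closure: `g` is a critical point there of `½‖g‖² - ∫ W(t, K
g)`. Because `α > 1/2`, the kernel is square integrable and `K` is compact from L² into continuous
functions with the sup norm (`isCompactOperator_rlOperator`).

The energy has mountain pass geometry: it is at least `¼‖g‖²` near 0, and by superquadraticity its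
set `{0 ≤ energy}` is bounded in every finite-dimensional subspace. There an elementary mountain
pass theorem suffices (`exists_critical_of_mountain_pass`). It is applied along Galerkin subspaces
sharing one endpoint `e`, which keeps all critical values between a positive constant and a fixed
`C`.

The Galerkin solutions are bounded (`isBounded_of_inner_eq`). If their norms blew up, the images
under `K` of the normalized vectors would converge uniformly along a subsequence. A nonzero limit
contradicts superquadraticity; a zero limit contradicts the bound on `∫ H` combined with the growth
condition on the gradient. Compactness of `K` then upgrades boundedness to strong convergence, and
the positive lower bound on the energy makes the limit nonzero (`exists_nontrivial_critical`). -/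

/-! ### Mountain pass theorem in finite dimension. -/

/-- A path from the origin to a point outside the ball of radius `r` meets the sphere. -/
theorem exists_norm_eq_of_path {V : Type*} [NormedAddCommGroup V] {γ : ℝ → V}
    (hγ : Continuous γ) (h0 : γ 0 = 0) {r : ℝ} (hr : 0 < r) (h1 : r < ‖γ 1‖) :
    ∃ s ∈ Icc (0 : ℝ) 1, ‖γ s‖ = r := by
  have := intermediate_value_Icc (zero_le_one' ℝ) (hγ.norm.continuousOn (s := Icc 0 1))
  obtain ⟨s, hs, h⟩ := this ⟨by simpa [h0] using hr.le, h1.le⟩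
  exact ⟨s, hs, h⟩

/-- Uniform decrease of a `C¹` function along short gradient steps started on a bounded set
where the gradient stays away from zero. -/
theorem exists_gradient_step {V : Type*} [NormedAddCommGroup V] [InnerProductSpace ℝ V]
    [FiniteDimensional ℝ V] {Φ : V → ℝ} {G : V → V}
    (hΦ : ∀ x, HasFDerivAt Φ (innerSL ℝ (G x)) x) (hG : Continuous G) {Z : Set V}
    (hZ : IsCompact Z) {δ : ℝ} (hδ : 0 < δ) :
    ∃ τ > 0, ∀ x ∈ Z, δ ≤ ‖G x‖ → ∀ s, 0 ≤ s → s ≤ τ →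
      Φ (x - s • G x) ≤ Φ x - s * δ ^ 2 / 2 := by
  have hZ' : IsCompact (Metric.cthickening 1 Z) := hZ.cthickening
  have huc := hZ'.uniformContinuousOn_of_continuous hG.continuousOn
  rw [Metric.uniformContinuousOn_iff] at huc
  obtain ⟨ρ, hρ, huc⟩ := huc (δ / 2) (by positivity)
  obtain ⟨B, hB⟩ := hZ.exists_bound_of_continuousOn hG.continuousOn
  set ρ' := min ρ 1 with hρ'
  have hρ'0 : 0 < ρ' := lt_min hρ one_pos
  -- With `‖G‖ ≤ |B| + 1` on `Z`, a step of this duration has length below `ρ'`, so it stays where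
  -- `G` varies by less than `δ / 2`.
  refine ⟨ρ' / (2 * (|B| + 1)), by positivity, fun x hx hgx s hs0 hs => ?_⟩
  have hstep : ‖s • G x‖ < ρ' := by
    rw [norm_smul, Real.norm_of_nonneg hs0]
    have h1 : ‖G x‖ ≤ |B| + 1 := (hB x hx).trans ((le_abs_self B).trans (by linarith))
    calc s * ‖G x‖ ≤ ρ' / (2 * (|B| + 1)) * (|B| + 1) := by gcongr
      _ = ρ' / 2 := by field_simp
      _ < ρ' := by linarith
  have hsub : ∀ y ∈ Metric.ball x ρ', y ∈ Metric.cthickening 1 Z := fun y hy =>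
    Metric.mem_cthickening_of_dist_le y x 1 Z hx
      ((Metric.mem_ball.1 hy).le.trans (min_le_right _ _))
  have hmv := (convex_ball x ρ').norm_image_sub_le_of_norm_hasFDerivWithin_le'
    (f := Φ) (f' := fun y => innerSL ℝ (G y)) (φ := innerSL ℝ (G x)) (C := δ / 2)
    (fun y _ => (hΦ y).hasFDerivWithinAt) (fun y hy => by
      rw [← map_sub, innerSL_apply_norm, ← dist_eq_norm]
      exact (huc y (hsub y hy) x (hsub x (Metric.mem_ball_self hρ'0))
        ((Metric.mem_ball.1 hy).trans_le (min_le_left _ _))).le)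
    (Metric.mem_ball_self hρ'0) (y := x - s • G x) (by simpa [mem_ball_iff_norm] using hstep)
  have h2 : x - s • G x - x = -(s • G x) := by abel
  rw [h2, norm_neg, norm_smul, Real.norm_of_nonneg hs0, map_neg, map_smul, innerSL_apply_apply,
    real_inner_self_eq_norm_sq, smul_eq_mul] at hmv
  have h3 := (abs_le.1 (Real.norm_eq_abs _ ▸ hmv)).2
  have h4 : δ ^ 2 / 2 ≤ ‖G x‖ ^ 2 - δ / 2 * ‖G x‖ := by nlinarith
  nlinarith [mul_le_mul_of_nonneg_left h4 hs0]

/-- The mountain pass theorem in finite dimension, for functions with bounded superlevel set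
`{0 ≤ Φ}`. -/
theorem exists_critical_of_mountain_pass {V : Type*} [NormedAddCommGroup V]
    [InnerProductSpace ℝ V] [FiniteDimensional ℝ V] {Φ : V → ℝ} {G : V → V}
    (hΦ : ∀ x, HasFDerivAt Φ (innerSL ℝ (G x)) x) (hG : Continuous G)
    (hbdd : Bornology.IsBounded {x | 0 ≤ Φ x}) {r κ C : ℝ} {e : V} (hκ : 0 < κ) (hr : 0 < r)
    (hsph : ∀ x, ‖x‖ = r → κ ≤ Φ x) (he : r < ‖e‖) (h0 : Φ 0 ≤ 0) (heΦ : Φ e ≤ 0)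
    (hseg : ∀ s ∈ Icc (0 : ℝ) 1, Φ (s • e) ≤ C) :
    ∃ x, G x = 0 ∧ κ ≤ Φ x ∧ Φ x ≤ C := by
  have hΦc : Continuous Φ := continuous_iff_continuousAt.2 fun x => (hΦ x).continuousAt
  set A : Set ℝ := {M | ∃ γ : ℝ → V, Continuous γ ∧ γ 0 = 0 ∧ γ 1 = e ∧
    ∀ s ∈ Icc (0 : ℝ) 1, Φ (γ s) ≤ M} with hA
  have hCA : C ∈ A := ⟨fun s => s • e, by fun_prop, by simp, by simp, hseg⟩
  have hlb : ∀ M ∈ A, κ ≤ M := by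
    rintro M ⟨γ, hγ, hγ0, hγ1, hM⟩
    obtain ⟨s, hs, h⟩ := exists_norm_eq_of_path hγ hγ0 hr (hγ1 ▸ he)
    exact (hsph _ h).trans (hM s hs)
  have hAb : BddBelow A := ⟨κ, hlb⟩
  set c := sInf A with hc
  have hκc : κ ≤ c := le_csInf ⟨C, hCA⟩ hlb
  have hcC : c ≤ C := csInf_le hAb hCA
  by_contra! hno
  have hcrit : ∀ x, Φ x = c → G x ≠ 0 := fun x hx hgx => by
    have := hno x hgx (hx ▸ hκc)
    linarith
  have hZ : IsCompact {x | 0 ≤ Φ x} :=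
    Metric.isCompact_of_isClosed_isBounded (isClosed_le continuous_const hΦc) hbdd
  obtain ⟨s₀, -, hs₀⟩ := exists_norm_eq_of_path (γ := fun s : ℝ => s • e) (by fun_prop)
    (by simp) hr (by simpa using he)
  -- Substitute for the Palais-Smale condition: `|Φ - c| + ‖G‖` attains its minimum on a compact
  -- set, and this minimum is positive when the level `c` carries no critical point.
  obtain ⟨x₀, -, hmin⟩ := hZ.exists_isMinOn ⟨s₀ • e, hκ.le.trans (hsph _ hs₀)⟩
    (f := fun x => |Φ x - c| + ‖G x‖) (by fun_prop)
  set m := |Φ x₀ - c| + ‖G x₀‖ with hm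
  have hm0 : 0 < m := by
    by_cases h : Φ x₀ = c
    · have := norm_pos_iff.2 (hcrit x₀ h)
      positivity
    · have := abs_pos.2 (sub_ne_zero.2 h)
      positivity
  -- `ε ≤ m / 2` forces `‖G‖ ≥ m / 2` in the slab `|Φ - c| ≤ ε`; `ε ≤ c` keeps the slab inside `{0 ≤
  -- Φ}` and leaves both ends of a path fixed by the cut-off `χ` below.
  set ε := min (m / 2) c with hε
  have hε0 : 0 < ε := lt_min (by positivity) (hκ.trans_le hκc)
  have hslab : ∀ x, |Φ x - c| ≤ ε → 0 ≤ Φ x ∧ m / 2 ≤ ‖G x‖ := by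
    intro x hx
    have h1 : 0 ≤ Φ x := by
      have := (abs_le.1 hx).1
      have := min_le_right (m / 2) c
      linarith
    refine ⟨h1, ?_⟩
    have h2 : m ≤ |Φ x - c| + ‖G x‖ := hmin h1
    have := min_le_left (m / 2) c
    linarith
  obtain ⟨τ, hτ, hstep⟩ := exists_gradient_step hΦ hG hZ (half_pos hm0)
  -- The first bound keeps the step time `σ * χ` below `τ`, as `χ ≤ 2ε` on the path; the second
  -- gives `l ≤ 1`.
  set σ := min (τ / (2 * ε)) (2 / (m / 2) ^ 2) with hσ
  have hσ0 : 0 < σ := by positivity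
  set l := σ * (m / 2) ^ 2 / 2 with hl
  have hl0 : 0 < l := by positivity
  have hl1 : l ≤ 1 := by
    have : σ * (m / 2) ^ 2 ≤ 2 / (m / 2) ^ 2 * (m / 2) ^ 2 := by
      gcongr; exact min_le_right _ _
    rw [div_mul_cancel₀ _ (by positivity)] at this
    linarith
  obtain ⟨M, ⟨γ, hγ, hγ0, hγ1, hM⟩, hMc⟩ :=
    exists_lt_of_csInf_lt ⟨C, hCA⟩ (show sInf A < c + l * ε by rw [← hc]; nlinarith)
  set χ : V → ℝ := fun x => max 0 (Φ x - (c - ε)) with hχ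
  have hχ0 : ∀ x, Φ x ≤ 0 → χ x = 0 := fun x hx => max_eq_left (by
    have := min_le_right (m / 2) c
    linarith)
  -- One cut-off gradient step multiplies the excess over `c - ε` by at most `1 - l`. The excess was
  -- at most `(1 + l) ε`, so the new maximum is at most `c - l² ε`, below the infimum.
  have hnew : c - ε + (1 - l) * (ε + l * ε) ∈ A := by
    refine ⟨fun s => γ s - (σ * χ (γ s)) • G (γ s), by fun_prop, ?_, ?_, fun s hs => ?_⟩
    · simp [hγ0, hχ0 0 h0]
    · simp [hγ1, hχ0 e heΦ]
    · have hlε : l * ε ≤ ε := by nlinarith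
      have hx := hM s hs
      have hpos : 0 ≤ (1 - l) * (ε + l * ε) := mul_nonneg (by linarith) (by positivity)
      rcases le_total (Φ (γ s)) (c - ε) with h | h
      · have : χ (γ s) = 0 := max_eq_left (by linarith)
        simp only [this, mul_zero, zero_smul, sub_zero]
        linarith
      · have hχe : χ (γ s) = Φ (γ s) - (c - ε) := max_eq_right (by linarith)
        obtain ⟨h1, h2⟩ := hslab (γ s) (abs_le.2 ⟨by linarith, by linarith⟩)
        have hs' : σ * χ (γ s) ≤ τ := by
          calc σ * χ (γ s) ≤ τ / (2 * ε) * (2 * ε) := by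
                rw [hχe]
                exact mul_le_mul (min_le_left _ _) (by linarith) (by linarith) (by positivity)
            _ = τ := by field_simp
        have := hstep (γ s) h1 h2 (σ * χ (γ s))
          (mul_nonneg hσ0.le (le_max_left _ _)) hs'
        refine this.trans ?_
        rw [hχe]
        have h3 : σ * (Φ (γ s) - (c - ε)) * (m / 2) ^ 2 / 2 = l * (Φ (γ s) - (c - ε)) := by
          rw [hl]; ring
        rw [h3]
        nlinarith
  have := csInf_le hAb hnew
  rw [← hc] at this
  nlinarith [mul_pos (mul_pos hl0 hl0) hε0]

/-! ### The abstract energy functional and its derivative. -/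

section Energy

variable {T E H : Type*} [MetricSpace T] [CompactSpace T] [MeasurableSpace T] [BorelSpace T]
  [NormedAddCommGroup E] [InnerProductSpace ℝ E] [FiniteDimensional ℝ E]
  [NormedAddCommGroup H] [InnerProductSpace ℝ H]

/-- The superposition operator `u ↦ F(·, u(·))` on continuous functions. -/
def superposition {Y : Type*} [TopologicalSpace Y] {F : T → E → Y}
    (hF : Continuous (Function.uncurry F)) (u : C(T, E)) : C(T, Y) :=
  ⟨fun t => F t (u t), hF.comp (continuous_id.prodMk u.continuous)⟩

theorem continuous_superposition {Y : Type*} [TopologicalSpace Y] {F : T → E → Y}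
    (hF : Continuous (Function.uncurry F)) : Continuous (superposition hF) := by
  refine ContinuousMap.continuous_of_continuous_uncurry _ ?_
  exact hF.comp (continuous_snd.prodMk (continuous_eval.comp continuous_id))

theorem integrable_of_continuous {Y : Type*} [NormedAddCommGroup Y] [SecondCountableTopology Y]
    (μ : Measure T) [IsFiniteMeasure μ] {f : T → Y} (hf : Continuous f) : Integrable f μ :=
  Integrable.of_bound hf.aestronglyMeasurable ‖(⟨f, hf⟩ : C(T, Y))‖
    (ae_of_all _ fun t => ContinuousMap.norm_coe_le_norm ⟨f, hf⟩ t)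

/-- The `L²` pairing of continuous functions, as a bounded bilinear form for the sup norm. -/
def pairing (μ : Measure T) [IsFiniteMeasure μ] : C(T, E) →L[ℝ] C(T, E) →L[ℝ] ℝ :=
  have hi : ∀ f g : C(T, E), Integrable (fun t => inner ℝ (f t) (g t)) μ := fun f g =>
    integrable_of_continuous μ (by fun_prop)
  LinearMap.mkContinuous₂
    (LinearMap.mk₂ ℝ (fun f g : C(T, E) => ∫ t, inner ℝ (f t) (g t) ∂μ)
      (fun f f' g => by
        simp only [ContinuousMap.add_apply, inner_add_left]
        exact integral_add (hi f g) (hi f' g))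
      (fun c f g => by
        simp only [ContinuousMap.smul_apply, real_inner_smul_left, smul_eq_mul]
        exact integral_const_mul _ _)
      (fun f g g' => by
        simp only [ContinuousMap.add_apply, inner_add_right]
        exact integral_add (hi f g) (hi f g'))
      (fun c f g => by
        simp only [ContinuousMap.smul_apply, real_inner_smul_right, smul_eq_mul]
        exact integral_const_mul _ _))
    (μ.real univ)
    (fun f g => by
      simp only [LinearMap.mk₂_apply]
      calc ‖∫ t, inner ℝ (f t) (g t) ∂μ‖ ≤ (‖f‖ * ‖g‖) * μ.real univ :=
            norm_integral_le_of_norm_le_const (ae_of_all _ fun t => by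
              refine (norm_inner_le_norm (f t) (g t)).trans ?_
              gcongr
              · exact f.norm_coe_le_norm t
              · exact g.norm_coe_le_norm t)
        _ = μ.real univ * ‖f‖ * ‖g‖ := by ring)

theorem pairing_apply (μ : Measure T) [IsFiniteMeasure μ] (f g : C(T, E)) :
    pairing μ f g = ∫ t, inner ℝ (f t) (g t) ∂μ := rfl

/-- The adjoint of `K : H → C(T, E)`, restricted to continuous functions. -/
def coadjoint [CompleteSpace H] (μ : Measure T) [IsFiniteMeasure μ] (K : H →L[ℝ] C(T, E))
    (f : C(T, E)) : H :=
  (InnerProductSpace.toDual ℝ H).symm ((pairing μ f).comp K)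

theorem inner_coadjoint [CompleteSpace H] (μ : Measure T) [IsFiniteMeasure μ]
    (K : H →L[ℝ] C(T, E)) (f : C(T, E)) (h : H) :
    inner ℝ (coadjoint μ K f) h = ∫ t, inner ℝ (f t) (K h t) ∂μ := by
  simp [coadjoint, InnerProductSpace.toDual_symm_apply, pairing_apply]

theorem continuous_coadjoint [CompleteSpace H] (μ : Measure T) [IsFiniteMeasure μ]
    (K : H →L[ℝ] C(T, E)) : Continuous (coadjoint μ K) := by
  refine (InnerProductSpace.toDual ℝ H).symm.continuous.comp ?_
  exact (continuous_id.clm_comp continuous_const).comp (pairing μ).continuous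

/-- The mean value inequality is applied for each `t` separately; continuity of the superposition
operator for the sup norm makes the error uniform in `t`, so it can be integrated. -/
theorem hasFDerivAt_integral_superposition (μ : Measure T) [IsFiniteMeasure μ]
    {W : T → E → ℝ} {F : T → E → E}
    (hW : Continuous (Function.uncurry W)) (hF : Continuous (Function.uncurry F))
    (hgrad : ∀ t x, HasFDerivAt (W t) (innerSL ℝ (F t x)) x) (u : C(T, E)) :
    HasFDerivAt (fun u : C(T, E) => ∫ t, W t (u t) ∂μ) (pairing μ (superposition hF u)) u := by
  have hWi : ∀ v : C(T, E), Integrable (fun t => W t (v t)) μ := fun v =>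
    integrable_of_continuous μ (superposition hW v).continuous
  rw [hasFDerivAt_iff_isLittleO_nhds_zero, Asymptotics.isLittleO_iff]
  intro c hc
  set ε := c / (μ.real univ + 1) with hε
  have hm : 0 ≤ μ.real univ := measureReal_nonneg
  have hε0 : 0 < ε := by positivity
  have hcont := (continuous_superposition hF).continuousAt (x := u)
  rw [Metric.continuousAt_iff] at hcont
  obtain ⟨δ, hδ, hcont⟩ := hcont ε hε0
  filter_upwards [Metric.ball_mem_nhds (0 : C(T, E)) hδ] with v hv
  rw [mem_ball_zero_iff] at hv
  have hpt : ∀ t, ‖W t ((u + v) t) - W t (u t) - inner ℝ (superposition hF u t) (v t)‖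
      ≤ ε * ‖v‖ := by
    intro t
    have hvt : ‖v t‖ < δ := (v.norm_coe_le_norm t).trans_lt hv
    have hmv := (convex_ball (u t) δ).norm_image_sub_le_of_norm_hasFDerivWithin_le'
      (f := W t) (f' := fun y => innerSL ℝ (F t y)) (φ := innerSL ℝ (F t (u t))) (C := ε)
      (fun y _ => (hgrad t y).hasFDerivWithinAt) (fun y hy => by
        rw [← map_sub, innerSL_apply_norm]
        -- Translating `u` by the constant `y - u t` turns closeness of points in `E` into closeness
        -- in the sup norm.
        have h1 : dist (u + ContinuousMap.const T (y - u t)) u < δ := by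
          rw [dist_eq_norm, add_sub_cancel_left]
          refine (ContinuousMap.norm_lt_iff _ hδ).2 fun _ => ?_
          simpa [dist_eq_norm] using hy
        have h2 := ((superposition hF (u + ContinuousMap.const T (y - u t))
          - superposition hF u).norm_coe_le_norm t).trans
            ((dist_eq_norm _ _).symm.trans_le (hcont h1).le)
        have h3 : (superposition hF (u + ContinuousMap.const T (y - u t)) - superposition hF u) t
            = F t y - F t (u t) := by
          change F t (u t + (y - u t)) - F t (u t) = _
          rw [add_sub_cancel]
        rwa [h3] at h2)
      (Metric.mem_ball_self hδ) (y := (u + v) t)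
      (by simpa [mem_ball_iff_norm] using hvt)
    simp only [ContinuousMap.add_apply, add_sub_cancel_left, innerSL_apply_apply] at hmv ⊢
    exact hmv.trans (by gcongr; exact v.norm_coe_le_norm t)
  have hWd : Integrable (fun t => W t ((u + v) t) - W t (u t)) μ := (hWi _).sub (hWi _)
  rw [pairing_apply, ← integral_sub (hWi _) (hWi _), ← integral_sub hWd
    (integrable_of_continuous μ (by fun_prop))]
  refine (norm_integral_le_of_norm_le_const (ae_of_all _ hpt)).trans ?_
  have : ε * μ.real univ ≤ c := by
    rw [hε, div_mul_eq_mul_div, div_le_iff₀ (by positivity)]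
    nlinarith
  nlinarith [norm_nonneg v]

/-- The action functional `½ ‖g‖² - ∫ W(t, K g (t)) dt`. -/
def energy (μ : Measure T) (K : H →L[ℝ] C(T, E)) (W : T → E → ℝ) (g : H) : ℝ :=
  1 / 2 * ‖g‖ ^ 2 - ∫ t, W t (K g t) ∂μ

theorem hasFDerivAt_energy [CompleteSpace H] (μ : Measure T) [IsFiniteMeasure μ]
    (K : H →L[ℝ] C(T, E)) {W : T → E → ℝ} {F : T → E → E}
    (hW : Continuous (Function.uncurry W)) (hF : Continuous (Function.uncurry F))
    (hgrad : ∀ t x, HasFDerivAt (W t) (innerSL ℝ (F t x)) x) (g : H) :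
    HasFDerivAt (energy μ K W)
      (innerSL ℝ (g - coadjoint μ K (superposition hF (K g)))) g := by
  have h1 : HasFDerivAt (fun g : H => 1 / 2 * ‖g‖ ^ 2) (innerSL ℝ g) g := by
    have := ((hasStrictFDerivAt_norm_sq g).hasFDerivAt).const_mul (1 / 2 : ℝ)
    refine this.congr_fderiv ?_
    ext h
    simp
  have h2 := (hasFDerivAt_integral_superposition μ hW hF hgrad (K g)).comp g K.hasFDerivAt
  refine (h1.sub h2).congr_fderiv ?_
  ext h
  simp [inner_coadjoint, pairing_apply]

/-! ### Superquadratic growth, a priori bounds and mountain pass geometry. -/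

/-- If `‖g k‖ → ∞` and the images of the normalized vectors converge to a nonzero function, then
`∫ W(t, K (g k))` grows faster than `‖g k‖²`. -/
theorem eventually_mul_sq_le_integral (μ : Measure T) [IsFiniteMeasure μ] [μ.IsOpenPosMeasure]
    (K : H →L[ℝ] C(T, E)) {W : T → E → ℝ} (hW : Continuous (Function.uncurry W))
    (hW0 : ∀ t x, 0 ≤ W t x) (hsup : ∀ M : ℝ, ∃ r > 0, ∀ t x, r ≤ ‖x‖ → M * ‖x‖ ^ 2 ≤ W t x)
    {g : ℕ → H} (hg : Tendsto (fun k => ‖g k‖) atTop atTop) {w : C(T, E)} (hw : w ≠ 0)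
    (hKw : Tendsto (fun k => K (‖g k‖⁻¹ • g k)) atTop (𝓝 w)) :
    ∀ᶠ k in atTop, ‖g k‖ ^ 2 ≤ ∫ t, W t (K (g k) t) ∂μ := by
  obtain ⟨t₀, ht₀⟩ : ∃ t, w t ≠ 0 := by
    by_contra! h
    exact hw (ContinuousMap.ext h)
  set η := ‖w t₀‖ / 2 with hη
  have hη0 : 0 < η := half_pos (norm_pos_iff.2 ht₀)
  set U : Set T := {t | η < ‖w t‖} with hU
  have hUo : IsOpen U := isOpen_lt continuous_const (by fun_prop)
  have hUp : 0 < μ.real U := by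
    refine ENNReal.toReal_pos (hUo.measure_pos μ ⟨t₀, ?_⟩).ne' (measure_ne_top _ _)
    change η < ‖w t₀‖
    linarith [half_lt_self (norm_pos_iff.2 ht₀)]
  -- On `U` eventually `‖K (g k) t‖ ≥ (η / 2) ‖g k‖`, so this constant gives `W ≥ ‖g k‖² / μ(U)`
  -- there, and integrating over `U` yields `‖g k‖²`.
  obtain ⟨r, hr, hsup⟩ := hsup (4 / (η ^ 2 * μ.real U))
  have h1 : ∀ᶠ k in atTop, dist (K (‖g k‖⁻¹ • g k)) w < η / 2 :=
    (Metric.tendsto_nhds.1 hKw) _ (half_pos hη0)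
  filter_upwards [h1, hg.eventually_ge_atTop (2 * r / η), hg.eventually_gt_atTop 0]
    with k hk hk' hk0
  have hi : Integrable (fun t => W t (K (g k) t)) μ :=
    integrable_of_continuous μ (superposition hW (K (g k))).continuous
  have hlow : ∀ t ∈ U, ‖g k‖ ^ 2 / μ.real U ≤ W t (K (g k) t) := by
    intro t ht
    have h2 : ‖K (‖g k‖⁻¹ • g k) t - w t‖ ≤ η / 2 :=
      ((K (‖g k‖⁻¹ • g k) - w).norm_coe_le_norm t).trans
        ((dist_eq_norm _ _).symm.trans_le hk.le)
    have h3 : η / 2 ≤ ‖K (‖g k‖⁻¹ • g k) t‖ := by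
      have := norm_sub_norm_le (w t) (K (‖g k‖⁻¹ • g k) t)
      rw [norm_sub_rev] at this
      have : η < ‖w t‖ := ht
      linarith
    rw [map_smul, ContinuousMap.smul_apply, norm_smul, norm_inv, norm_norm,
      inv_mul_eq_div, le_div_iff₀ hk0] at h3
    have h4 : r ≤ ‖K (g k) t‖ := by
      rw [div_le_iff₀ hη0] at hk'
      linarith
    refine le_trans ?_ (hsup t _ h4)
    calc ‖g k‖ ^ 2 / μ.real U = 4 / (η ^ 2 * μ.real U) * (η / 2 * ‖g k‖) ^ 2 := by
          field_simp; norm_num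
      _ ≤ _ := by gcongr
  calc ‖g k‖ ^ 2 = ∫ _ in U, ‖g k‖ ^ 2 / μ.real U ∂μ := by
        rw [setIntegral_const, smul_eq_mul]; field_simp
    _ ≤ ∫ t in U, W t (K (g k) t) ∂μ :=
        setIntegral_mono_on integrableOn_const hi.integrableOn hUo.measurableSet hlow
    _ ≤ ∫ t, W t (K (g k) t) ∂μ :=
        setIntegral_le_integral hi (ae_of_all _ fun t => hW0 t _)

/-- Along an unbounded sequence the normalized vectors subconverge on the compact unit sphere, and
injectivity of `K` makes the image of the limit nonzero. Then `∫ W ≥ ‖g‖²` makes the energy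
negative. -/
theorem isBounded_superlevel_of_finiteDimensional (μ : Measure T) [IsFiniteMeasure μ]
    [μ.IsOpenPosMeasure] (K : H →L[ℝ] C(T, E)) (hK : Function.Injective K) {W : T → E → ℝ}
    (hW : Continuous (Function.uncurry W)) (hW0 : ∀ t x, 0 ≤ W t x)
    (hsup : ∀ M : ℝ, ∃ r > 0, ∀ t x, r ≤ ‖x‖ → M * ‖x‖ ^ 2 ≤ W t x)
    (V : Submodule ℝ H) [FiniteDimensional ℝ V] :
    Bornology.IsBounded {g : V | 0 ≤ energy μ K W (g : H)} := by
  rw [isBounded_iff_forall_norm_le]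
  by_contra! h
  choose g hg hgk using fun k : ℕ => h k
  have hgt : Tendsto (fun k => ‖g k‖) atTop atTop :=
    tendsto_atTop_mono (fun k => (hgk k).le) tendsto_natCast_atTop_atTop
  have hne : ∀ k, ‖g k‖ ≠ 0 := fun k => ((Nat.cast_nonneg k).trans_lt (hgk k)).ne'
  obtain ⟨w, hw, φ, hφ, hlim⟩ := (isCompact_sphere (0 : V) 1).tendsto_subseq
    (x := fun k => ‖g k‖⁻¹ • g k) (fun k => by simp only [mem_sphere_zero_iff_norm, norm_smul, norm_inv, norm_norm]; exact inv_mul_cancel₀ (hne k))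
  have hw0 : K (w : H) ≠ 0 := fun h0 => by
    have : (w : H) = 0 := hK (h0.trans (map_zero K).symm)
    have hw' : w = 0 := by exact_mod_cast this
    simp [hw'] at hw
  have := eventually_mul_sq_le_integral μ K hW hW0 hsup (g := fun k => (g (φ k) : H))
    (hgt.comp hφ.tendsto_atTop) hw0
    (((K.continuous.comp continuous_subtype_val).tendsto w).comp hlim)
  obtain ⟨k, hk⟩ := this.exists
  have h1 : 0 ≤ energy μ K W (g (φ k) : H) := hg (φ k)
  have h2 : 0 < ‖(g (φ k) : H)‖ ^ 2 := pow_pos (lt_of_le_of_ne (norm_nonneg _) (hne _).symm) 2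
  rw [energy] at h1
  linarith

/-- A priori bound for the vectors that are critical in their own direction and have bounded
nonnegative energy. -/
theorem isBounded_of_inner_eq (μ : Measure T) [IsFiniteMeasure μ]
    [μ.IsOpenPosMeasure] (K : H →L[ℝ] C(T, E)) (hKc : IsCompactOperator K) {W : T → E → ℝ}
    {F : T → E → E}
    (hW : Continuous (Function.uncurry W)) (hF : Continuous (Function.uncurry F))
    (hW0 : ∀ t x, 0 ≤ W t x)
    (hH0 : ∀ t x, 0 ≤ 1 / 2 * inner ℝ (F t x) x - W t x)
    (hsup : ∀ M : ℝ, ∃ r > 0, ∀ t x, r ≤ ‖x‖ → M * ‖x‖ ^ 2 ≤ W t x)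
    {C₀ R : ℝ} (hC₀ : 0 ≤ C₀)
    (hgr : ∀ t x, R ≤ ‖x‖ →
      ‖F t x‖ ≤ (1 + C₀ * (1 / 2 * inner ℝ (F t x) x - W t x)) * ‖x‖) (C : ℝ) :
    ∃ B, ∀ g : H, 0 ≤ energy μ K W g → energy μ K W g ≤ C →
      ‖g‖ ^ 2 = ∫ t, inner ℝ (F t (K g t)) (K g t) ∂μ → ‖g‖ ≤ B := by
  by_contra! h
  choose g hg hgC hgg hgk using fun k : ℕ => h k
  have hgt : Tendsto (fun k => ‖g k‖) atTop atTop :=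
    tendsto_atTop_mono (fun k => (hgk k).le) tendsto_natCast_atTop_atTop
  have hpos : ∀ k, 0 < ‖g k‖ := fun k => (Nat.cast_nonneg k).trans_lt (hgk k)
  have hcomp := hKc.isCompact_closure_image_closedBall 1
  obtain ⟨w, -, φ, hφ, hlim⟩ := hcomp.tendsto_subseq
    (x := fun k => K (‖g k‖⁻¹ • g k)) (fun k => subset_closure
      (mem_image_of_mem _ (by simp [norm_smul, (hpos k).ne'])))
  have hgφ : Tendsto (fun k => ‖g (φ k)‖) atTop atTop := hgt.comp hφ.tendsto_atTop
  by_cases hw : w = 0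
  -- Vanishing case: `⟨F, x⟩` is bounded for `‖x‖ ≤ R` and is at most `(1 + C₀ H) ‖x‖²` beyond.
  -- Dividing the integrated estimate by `‖g k‖²` leads to `1 ≤ 0` in the limit.
  · obtain ⟨B, hB⟩ := (isCompact_univ.prod (isCompact_closedBall (0 : E) |R|)).exists_bound_of_continuousOn
      (f := fun p : T × E => inner ℝ (F p.1 p.2) p.2) (by
        have : Continuous fun p : T × E => F p.1 p.2 := hF
        fun_prop)
    have hest : ∀ k, 1 ≤ |B| * μ.real univ * (‖g k‖ ^ 2)⁻¹ +
        ‖K (‖g k‖⁻¹ • g k)‖ ^ 2 * (μ.real univ + C₀ * C) := by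
      intro k
      set u := K (g k) with hu
      have hFc : Continuous fun t => F t (u t) := (superposition hF u).continuous
      have hWc : Continuous fun t => W t (u t) := (superposition hW u).continuous
      have hHi : Integrable (fun t => 1 / 2 * inner ℝ (F t (u t)) (u t) - W t (u t)) μ :=
        integrable_of_continuous μ (by fun_prop)
      -- Criticality of `g` in its own direction makes the energy equal to the integral of `H`.
      have hIH : ∫ t, (1 / 2 * inner ℝ (F t (u t)) (u t) - W t (u t)) ∂μ ≤ C := by
        rw [integral_sub (integrable_of_continuous μ (by fun_prop))
          (integrable_of_continuous μ hWc), integral_const_mul, ← hgg k]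
        exact hgC k
      have hun : ‖u‖ = ‖g k‖ * ‖K (‖g k‖⁻¹ • g k)‖ := by
        rw [map_smul, norm_smul, norm_inv, norm_norm, mul_inv_cancel_left₀ (hpos k).ne']
      have hptw : ∀ t, inner ℝ (F t (u t)) (u t) ≤
          |B| + ‖u‖ ^ 2 * (1 + C₀ * (1 / 2 * inner ℝ (F t (u t)) (u t) - W t (u t))) := by
        intro t
        have h1 : 0 ≤ C₀ * (1 / 2 * inner ℝ (F t (u t)) (u t) - W t (u t)) :=
          mul_nonneg hC₀ (hH0 _ _)
        rcases le_total R ‖u t‖ with h | h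
        · have h2 := real_inner_le_norm (F t (u t)) (u t)
          have h3 := hgr t _ h
          have h4 := u.norm_coe_le_norm t
          have h5 : ‖F t (u t)‖ * ‖u t‖ ≤
              (1 + C₀ * (1 / 2 * inner ℝ (F t (u t)) (u t) - W t (u t))) * ‖u t‖ * ‖u t‖ := by
            gcongr
          have h6 : (1 + C₀ * (1 / 2 * inner ℝ (F t (u t)) (u t) - W t (u t))) * ‖u t‖ * ‖u t‖ ≤
              (1 + C₀ * (1 / 2 * inner ℝ (F t (u t)) (u t) - W t (u t))) * ‖u‖ * ‖u‖ := by
            gcongr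
          nlinarith [abs_nonneg B]
        · have h2 := hB (t, u t) ⟨mem_univ _, by simpa using h.trans (le_abs_self R)⟩
          have h3 := (le_abs_self _).trans h2
          simp only at h3
          have h4 := le_abs_self B
          have h5 : 0 ≤ ‖u‖ ^ 2 *
              (1 + C₀ * (1 / 2 * inner ℝ (F t (u t)) (u t) - W t (u t))) := by positivity
          linarith
      have hint : ‖g k‖ ^ 2 ≤ |B| * μ.real univ + ‖u‖ ^ 2 * (μ.real univ + C₀ * C) := by
        rw [hgg k]
        calc ∫ t, inner ℝ (F t (u t)) (u t) ∂μ ≤ ∫ t, (|B| + ‖u‖ ^ 2 *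
              (1 + C₀ * (1 / 2 * inner ℝ (F t (u t)) (u t) - W t (u t)))) ∂μ :=
            integral_mono (integrable_of_continuous μ (by fun_prop))
              (integrable_of_continuous μ (by fun_prop)) hptw
          _ = |B| * μ.real univ + ‖u‖ ^ 2 * (μ.real univ +
              C₀ * ∫ t, (1 / 2 * inner ℝ (F t (u t)) (u t) - W t (u t)) ∂μ) := by
            rw [integral_add (integrable_const _) (integrable_of_continuous μ (by fun_prop)),
              integral_const_mul, integral_add (integrable_const _) (hHi.const_mul _),
              integral_const_mul]
            simp [mul_comm]
          _ ≤ _ := by gcongr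
      have h7 : 0 < ‖g k‖ ^ 2 := pow_pos (hpos k) 2
      rw [hun, mul_pow] at hint
      have h8 := mul_le_mul_of_nonneg_right hint (inv_nonneg.2 h7.le)
      rw [mul_inv_cancel₀ h7.ne'] at h8
      refine h8.trans (le_of_eq ?_)
      rw [add_mul, mul_assoc (‖g k‖ ^ 2), mul_comm (‖g k‖ ^ 2), mul_assoc _ (‖g k‖ ^ 2),
        mul_inv_cancel₀ h7.ne', mul_one]
    have hlim0 : Tendsto (fun k => |B| * μ.real univ * (‖g (φ k)‖ ^ 2)⁻¹ +
        ‖K (‖g (φ k)‖⁻¹ • g (φ k))‖ ^ 2 * (μ.real univ + C₀ * C)) atTop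
        (𝓝 (|B| * μ.real univ * 0 + ‖w‖ ^ 2 * (μ.real univ + C₀ * C))) := by
      refine Tendsto.add (Tendsto.const_mul _ ?_) ((hlim.norm.pow 2).mul_const _)
      exact tendsto_inv_atTop_zero.comp ((tendsto_pow_atTop two_ne_zero).comp hgφ)
    have := ge_of_tendsto' hlim0 fun k => hest (φ k)
    simp [hw] at this
    norm_num at this
  · obtain ⟨k, hk⟩ := (eventually_mul_sq_le_integral μ K hW hW0 hsup (g := fun k => g (φ k))
      hgφ hw hlim).exists
    have h1 := hg (φ k)
    have h2 := pow_pos (hpos (φ k)) 2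
    rw [energy] at h1
    linarith

/-- Critical points of the restriction of the energy to a finite-dimensional subspace, at a
mountain pass level. -/
theorem exists_critical_in_subspace [CompleteSpace H] (μ : Measure T) [IsFiniteMeasure μ]
    [μ.IsOpenPosMeasure] (K : H →L[ℝ] C(T, E)) (hK : Function.Injective K)
    {W : T → E → ℝ} {F : T → E → E}
    (hW : Continuous (Function.uncurry W)) (hF : Continuous (Function.uncurry F))
    (hgrad : ∀ t x, HasFDerivAt (W t) (innerSL ℝ (F t x)) x)
    (hW0 : ∀ t x, 0 ≤ W t x)
    (hsup : ∀ M : ℝ, ∃ r > 0, ∀ t x, r ≤ ‖x‖ → M * ‖x‖ ^ 2 ≤ W t x)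
    (V : Submodule ℝ H) [FiniteDimensional ℝ V] {r κ C : ℝ} {e : H} (heV : e ∈ V) (hκ : 0 < κ)
    (hr : 0 < r) (hsph : ∀ x : H, ‖x‖ = r → κ ≤ energy μ K W x) (he : r < ‖e‖)
    (heΦ : energy μ K W e ≤ 0) (hseg : ∀ s ∈ Icc (0 : ℝ) 1, energy μ K W (s • e) ≤ C) :
    ∃ g ∈ V, κ ≤ energy μ K W g ∧ energy μ K W g ≤ C ∧
      g = V.starProjection (coadjoint μ K (superposition hF (K g))) := by
  have hJ : Continuous fun g : H => coadjoint μ K (superposition hF (K g)) :=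
    (continuous_coadjoint μ K).comp ((continuous_superposition hF).comp K.continuous)
  obtain ⟨g, hg, h1, h2⟩ := exists_critical_of_mountain_pass
    (Φ := fun g : V => energy μ K W (g : H))
    (G := fun g : V => g - V.orthogonalProjectionOnto (coadjoint μ K (superposition hF (K g))))
    (fun g => by
      have := (hasFDerivAt_energy μ K hW hF hgrad (g : H)).comp g V.subtypeL.hasFDerivAt
      refine this.congr_fderiv ?_
      ext h
      simp)
    (by
      exact continuous_id.sub
        (V.orthogonalProjectionOnto.continuous.comp (hJ.comp V.subtypeL.continuous)))
    (isBounded_superlevel_of_finiteDimensional μ K hK hW hW0 hsup V)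
    hκ hr (fun x hx => hsph x hx) (e := ⟨e, heV⟩) he
    (by
      have : 0 ≤ ∫ t, W t (K 0 t) ∂μ := integral_nonneg fun t => hW0 t _
      simp only [energy, ZeroMemClass.coe_zero, norm_zero]
      linarith) heΦ hseg
  refine ⟨g, g.2, h1, h2, ?_⟩
  have := congrArg (Subtype.val) (sub_eq_zero.1 hg)
  simpa using this

/-- `K` is bounded into the sup norm, so a small ball of `H` lands where `W` is at most a small
multiple of `‖x‖²`; the multiple is chosen so that `∫ W` uses only half of `½‖g‖²`. -/
theorem quarter_sq_le_energy (μ : Measure T) [IsFiniteMeasure μ] (K : H →L[ℝ] C(T, E))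
    {W : T → E → ℝ} (hW : Continuous (Function.uncurry W))
    (hsmall : ∀ ε > 0, ∃ δ > 0, ∀ t x, ‖x‖ < δ → W t x ≤ ε * ‖x‖ ^ 2) :
    ∃ r > 0, ∀ g : H, ‖g‖ ≤ r → 1 / 4 * ‖g‖ ^ 2 ≤ energy μ K W g := by
  have hm : 0 ≤ μ.real univ := measureReal_nonneg
  set a := μ.real univ * ‖K‖ ^ 2 + 1 with ha
  have ha0 : 0 < a := by positivity
  obtain ⟨δ, hδ, hsmall⟩ := hsmall (1 / (4 * a)) (by positivity)
  refine ⟨δ / (2 * (‖K‖ + 1)), by positivity, fun g hg => ?_⟩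
  have hKg : ‖K g‖ < δ := by
    calc ‖K g‖ ≤ ‖K‖ * ‖g‖ := K.le_opNorm g
      _ ≤ (‖K‖ + 1) * (δ / (2 * (‖K‖ + 1))) := by gcongr; linarith
      _ = δ / 2 := by field_simp
      _ < δ := half_lt_self hδ
  have h1 : ∫ t, W t (K g t) ∂μ ≤ ∫ _, 1 / (4 * a) * (‖K‖ * ‖g‖) ^ 2 ∂μ := by
    refine integral_mono (integrable_of_continuous μ (superposition hW (K g)).continuous)
      (integrable_const _) fun t => ?_
    have h2 := (K g).norm_coe_le_norm t
    refine (hsmall t _ (h2.trans_lt hKg)).trans ?_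
    gcongr
    exact h2.trans (K.le_opNorm g)
  rw [integral_const, smul_eq_mul] at h1
  have h3 : μ.real univ * (1 / (4 * a) * (‖K‖ * ‖g‖) ^ 2) ≤ 1 / 4 * ‖g‖ ^ 2 := by
    calc μ.real univ * (1 / (4 * a) * (‖K‖ * ‖g‖) ^ 2)
        = (μ.real univ * ‖K‖ ^ 2) * (‖g‖ ^ 2 / (4 * a)) := by ring
      _ ≤ a * (‖g‖ ^ 2 / (4 * a)) := by gcongr; linarith
      _ = 1 / 4 * ‖g‖ ^ 2 := by field_simp
  rw [energy]
  linarith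

/-! ### Galerkin approximation and passage to the limit. -/

/-- Existence of a nontrivial critical point of the energy on the closure of a subspace, by
Galerkin approximation. -/
theorem exists_nontrivial_critical [CompleteSpace H] [TopologicalSpace.SeparableSpace H]
    (μ : Measure T) [IsFiniteMeasure μ]
    [μ.IsOpenPosMeasure] (K : H →L[ℝ] C(T, E)) (hKc : IsCompactOperator K)
    (hK : Function.Injective K) {W : T → E → ℝ} {F : T → E → E}
    (hW : Continuous (Function.uncurry W)) (hF : Continuous (Function.uncurry F))
    (hgrad : ∀ t x, HasFDerivAt (W t) (innerSL ℝ (F t x)) x)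
    (hW0 : ∀ t x, 0 ≤ W t x)
    (hH0 : ∀ t x, 0 ≤ 1 / 2 * inner ℝ (F t x) x - W t x)
    (hsmall : ∀ ε > 0, ∃ δ > 0, ∀ t x, ‖x‖ < δ → W t x ≤ ε * ‖x‖ ^ 2)
    (hsup : ∀ M : ℝ, ∃ r > 0, ∀ t x, r ≤ ‖x‖ → M * ‖x‖ ^ 2 ≤ W t x)
    {C₀ R : ℝ} (hC₀ : 0 ≤ C₀)
    (hgr : ∀ t x, R ≤ ‖x‖ →
      ‖F t x‖ ≤ (1 + C₀ * (1 / 2 * inner ℝ (F t x) x - W t x)) * ‖x‖)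
    (S : Submodule ℝ H) (hS : S ≠ ⊥) :
    ∃ z ∈ S.topologicalClosure, z ≠ 0 ∧ ∀ h ∈ S.topologicalClosure,
      inner ℝ z h = ∫ t, inner ℝ (F t (K z t)) (K h t) ∂μ := by
  obtain ⟨g₀, hg₀S, hg₀⟩ := S.ne_bot_iff.1 hS
  have : SecondCountableTopology H := UniformSpace.secondCountable_of_separable H
  set d : ℕ → S := TopologicalSpace.denseSeq S with hd
  -- Every `V m` contains `g₀`, so one endpoint `e` on its line serves all of them and the bounds on
  -- the critical values do not depend on `m`.
  set V : ℕ → Submodule ℝ H := fun m =>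
    Submodule.span ℝ (insert g₀ ((fun i => (d i : H)) '' Iio m)) with hV
  have hfd : ∀ m, FiniteDimensional ℝ (V m) := fun m =>
    FiniteDimensional.span_of_finite ℝ (((finite_Iio m).image _).insert _)
  have hVmono : Monotone V := fun i j hij =>
    Submodule.span_mono (insert_subset_insert (image_mono (Iio_subset_Iio hij)))
  have hg₀V : ∀ m, g₀ ∈ V m := fun m => Submodule.subset_span (mem_insert _ _)
  have hVS : (⨆ m, V m).topologicalClosure = S.topologicalClosure := by
    apply le_antisymm
    · refine Submodule.topologicalClosure_mono (iSup_le fun m => Submodule.span_le.2 ?_)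
      rintro x (rfl | ⟨i, -, rfl⟩)
      · exact hg₀S
      · exact (d i).2
    · refine Submodule.topologicalClosure_minimal _ (fun x hx => ?_)
        (Submodule.isClosed_topologicalClosure _)
      have h1 : (⟨x, hx⟩ : S) ∈ closure (range d) := TopologicalSpace.denseRange_denseSeq S _
      have h2 := image_closure_subset_closure_image (continuous_subtype_val (p := (· ∈ S)))
        (mem_image_of_mem _ h1)
      refine closure_mono ?_ h2
      rintro _ ⟨_, ⟨i, rfl⟩, rfl⟩
      exact (le_iSup V (i + 1)) (Submodule.subset_span
        (mem_insert_of_mem _ ⟨i, Nat.lt_succ_self i, rfl⟩))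
  have hΦc : Continuous (energy μ K W) := continuous_iff_continuousAt.2 fun x =>
    (hasFDerivAt_energy μ K hW hF hgrad x).continuousAt
  obtain ⟨r, hr, hrsq⟩ := quarter_sq_le_energy μ K hW hsmall
  obtain ⟨B₀, hB₀⟩ := isBounded_iff_forall_norm_le.1
    (isBounded_superlevel_of_finiteDimensional μ K hK hW hW0 hsup (V 0))
  -- Longer than `B₀`, hence outside `{0 ≤ energy}` on `V 0`, and longer than `r`, hence beyond the
  -- sphere.
  set e : H := ((max B₀ r + 1) / ‖g₀‖) • g₀ with he
  have hpos : 0 < max B₀ r + 1 := by linarith [le_max_right B₀ r]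
  have hen : ‖e‖ = max B₀ r + 1 := by
    rw [he, norm_smul, Real.norm_of_nonneg (by positivity),
      div_mul_cancel₀ _ (norm_ne_zero_iff.2 hg₀)]
  have heV : ∀ m, e ∈ V m := fun m => (V m).smul_mem _ (hg₀V m)
  have heΦ : energy μ K W e ≤ 0 := by
    by_contra! h
    have h1 : ‖e‖ ≤ B₀ := hB₀ ⟨e, heV 0⟩ h.le
    linarith [le_max_left B₀ r]
  obtain ⟨C, hC⟩ := (isCompact_Icc (a := (0 : ℝ)) (b := 1)).exists_bound_of_continuousOn
    (f := fun s : ℝ => energy μ K W (s • e)) (by fun_prop)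
  have hκ : 0 < 1 / 4 * r ^ 2 := by positivity
  choose g hgV hgκ hgC hgP using fun m => exists_critical_in_subspace μ K hK hW hF hgrad hW0 hsup
    (V m) (heV m) hκ hr (fun x hx => hx ▸ hrsq x hx.le)
    (by linarith [le_max_right B₀ r]) heΦ (fun s hs => (le_abs_self _).trans (hC s hs))
  obtain ⟨B, hB⟩ := isBounded_of_inner_eq μ K hKc hW hF hW0 hH0 hsup hC₀ hgr C
  -- Pairing `g = P_V J(g)` with `g` itself, where `P_V` is self-adjoint and fixes `g`, gives the
  -- identity required by the a priori bound.
  have hgB : ∀ m, ‖g m‖ ≤ B := fun m => hB _ (hκ.le.trans (hgκ m)) (hgC m) (by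
    have h1 := inner_coadjoint μ K (superposition hF (K (g m))) (g m)
    rw [← real_inner_self_eq_norm_sq]
    refine Eq.trans ?_ h1
    conv_lhs => rw [hgP m, ← hgP m]
    nth_rewrite 1 [hgP m]
    rw [Submodule.inner_starProjection_left_eq_right, Submodule.starProjection_eq_self_iff.2 (hgV m)])
  obtain ⟨y, -, φ, hφ, hlim⟩ := (hKc.isCompact_closure_image_closedBall B).tendsto_subseq
    (x := fun m => K (g m)) (fun m => subset_closure
      (mem_image_of_mem _ (by simpa using hgB m)))
  set x := coadjoint μ K (superposition hF y) with hx
  have hxlim : Tendsto (fun m => coadjoint μ K (superposition hF (K (g (φ m))))) atTop (𝓝 x) :=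
    (((continuous_coadjoint μ K).comp (continuous_superposition hF)).tendsto y).comp hlim
  have : (⨆ m, V m).topologicalClosure.HasOrthogonalProjection := by
    have : CompleteSpace (⨆ m, V m).topologicalClosure :=
      (Submodule.isClosed_topologicalClosure _).completeSpace_coe
    infer_instance
  set P := (⨆ m, V m).topologicalClosure.starProjection with hP
  have hPlim := (Submodule.starProjection_tendsto_closure_iSup V hVmono x).comp hφ.tendsto_atTop
  -- The vectors `J(g)` converge strongly because they depend on `g` only through `K g`; the
  -- projections are contractions converging pointwise to `P`, so the Galerkin solutions converge in
  -- norm.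
  have hglim : Tendsto (fun m => g (φ m)) atTop (𝓝 (P x)) := by
    have h1 : Tendsto (fun m => (V (φ m)).starProjection
        (coadjoint μ K (superposition hF (K (g (φ m)))) - x)) atTop (𝓝 0) := by
      refine squeeze_zero_norm (fun m => Submodule.norm_starProjection_apply_le _ _) ?_
      simpa using (hxlim.sub_const x).norm
    have h2 := h1.add hPlim
    rw [zero_add] at h2
    refine h2.congr fun m => ?_
    simp only [Function.comp_apply]
    rw [← map_add, sub_add_cancel, ← hgP]
  have hKz : K (P x) = y := tendsto_nhds_unique ((K.continuous.tendsto _).comp hglim) hlim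
  refine ⟨P x, ?_, ?_, fun h hh => ?_⟩
  · rw [← hVS]
    exact Submodule.starProjection_apply_mem _ _
  · intro h0
    have h1 : 1 / 4 * r ^ 2 ≤ energy μ K W (P x) :=
      ge_of_tendsto' ((hΦc.tendsto _).comp hglim) fun m => hgκ (φ m)
    have h2 : 0 ≤ ∫ t, W t (K 0 t) ∂μ := integral_nonneg fun t => hW0 t _
    rw [h0, energy, norm_zero] at h1
    linarith
  · rw [← hVS] at hh
    rw [hKz, hP, Submodule.inner_starProjection_left_eq_right, Submodule.starProjection_eq_self_iff.2 hh, hx]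
    exact inner_coadjoint μ K _ h

end Energy

/-! ### The Riemann-Liouville kernel and its L² estimates. -/

/-- The kernel `(t - s)₊^(γ - 1)` of the Riemann-Liouville integral. -/
def rlKernel (γ t s : ℝ) : ℝ := if s < t then (t - s) ^ (γ - 1) else 0

theorem rlKernel_nonneg (γ t s : ℝ) : 0 ≤ rlKernel γ t s := by
  unfold rlKernel
  split_ifs with h
  · exact Real.rpow_nonneg (by linarith) _
  · exact le_rfl

theorem measurable_rlKernel_uncurry (γ : ℝ) :
    Measurable fun p : ℝ × ℝ => rlKernel γ p.1 p.2 :=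
  Measurable.ite (measurableSet_lt measurable_snd measurable_fst) (by fun_prop) measurable_const

theorem measurable_rlKernel (γ t : ℝ) : Measurable (rlKernel γ t) :=
  (measurable_rlKernel_uncurry γ).comp (measurable_const.prodMk measurable_id)

theorem rlKernel_eq_indicator (γ t : ℝ) :
    rlKernel γ t = (Iio t).indicator fun s => (t - s) ^ (γ - 1) := by
  ext s
  simp [rlKernel, indicator_apply]

theorem intervalIntegrable_sub_rpow {γ : ℝ} (hγ : 0 < γ) (c t : ℝ) :
    IntervalIntegrable (fun s => (t - s) ^ (γ - 1)) volume c t := by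
  have := (intervalIntegral.intervalIntegrable_rpow' (a := t - c) (b := 0)
    (show -1 < γ - 1 by linarith)).comp_sub_left t
  simpa using this

theorem integral_sub_rpow {γ : ℝ} (hγ : 0 < γ) (c t : ℝ) :
    ∫ s in c..t, (t - s) ^ (γ - 1) = (t - c) ^ γ / γ := by
  rw [intervalIntegral.integral_comp_sub_left (fun x => x ^ (γ - 1)) t,
    integral_rpow (Or.inl (by linarith))]
  simp [Real.zero_rpow hγ.ne']

section Interval

variable {a b : ℝ}

theorem setIntegral_rlKernel {Y : Type*} [NormedAddCommGroup Y] [NormedSpace ℝ Y] (γ : ℝ) {t : ℝ}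
    (ht : t ∈ Icc a b) (u : ℝ → Y) :
    ∫ s in Icc a b, rlKernel γ t s • u s = ∫ s in a..t, (t - s) ^ (γ - 1) • u s := by
  have h1 : (fun s => rlKernel γ t s • u s)
      = (Iio t).indicator fun s => (t - s) ^ (γ - 1) • u s := by
    ext s
    simp only [rlKernel, indicator_apply, mem_Iio]
    split_ifs <;> simp
  have h2 : Icc a b ∩ Iio t = Ico a t := by
    ext s
    simp only [mem_inter_iff, mem_Icc, mem_Iio, mem_Ico]
    exact ⟨fun h => ⟨h.1.1, h.2⟩, fun h => ⟨⟨h.1, h.2.le.trans ht.2⟩, h.2⟩⟩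
  rw [h1, setIntegral_indicator measurableSet_Iio, h2, integral_Ico_eq_integral_Ioo,
    intervalIntegral.integral_of_le ht.1, integral_Ioc_eq_integral_Ioo]

theorem rlIntegral_eq {n : ℕ} (γ : ℝ) {t : ℝ} (ht : t ∈ Icc a b)
    (u : ℝ → EuclideanSpace ℝ (Fin n)) :
    rlIntegral a γ u t = (1 / Real.Gamma γ) • ∫ s in Icc a b, rlKernel γ t s • u s := by
  rw [rlIntegral, setIntegral_rlKernel γ ht]

theorem integrableOn_rlKernel {γ : ℝ} (hγ : 0 < γ) {t : ℝ} (ht : t ∈ Icc a b) :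
    IntegrableOn (rlKernel γ t) (Icc a b) := by
  have h := (intervalIntegrable_iff_integrableOn_Ico_of_le ht.1).1
    (intervalIntegrable_sub_rpow hγ a t)
  rw [rlKernel_eq_indicator, integrableOn_indicator_iff measurableSet_Iio]
  refine h.mono_set ?_
  rintro s ⟨h1, h2⟩
  exact ⟨h2.1, h1⟩

theorem integral_rlKernel {γ : ℝ} (hγ : 0 < γ) {t : ℝ} (ht : t ∈ Icc a b) :
    ∫ s in Icc a b, rlKernel γ t s = (t - a) ^ γ / γ := by
  have := setIntegral_rlKernel γ ht (fun _ => (1 : ℝ))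
  simp only [smul_eq_mul, mul_one] at this
  rw [this, integral_sub_rpow hγ]

theorem rlKernel_sq (α t s : ℝ) : rlKernel α t s ^ 2 = rlKernel (2 * α - 1) t s := by
  unfold rlKernel
  split_ifs with h
  · rw [← Real.rpow_natCast, ← Real.rpow_mul (by linarith)]
    congr 1
    push_cast
    ring
  · simp

theorem memLp_rlKernel {α : ℝ} (hα : 1 / 2 < α) {t : ℝ} (ht : t ∈ Icc a b) :
    MemLp (rlKernel α t) 2 (volume.restrict (Icc a b)) := by
  rw [memLp_two_iff_integrable_sq (measurable_rlKernel α t).aestronglyMeasurable]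
  simp only [rlKernel_sq]
  exact integrableOn_rlKernel (by linarith) ht

/-- For `s < t` the kernel decreases in its first argument, and `(y - x)² ≤ y² - x²` for `0 ≤ x ≤ y`
replaces the square of the difference by a difference of kernels of order `2α - 1`, which integrate
explicitly. On `[t, t']` only one kernel survives. -/
theorem integral_sq_rlKernel_sub_le {α : ℝ} (hα : 1 / 2 < α) (hα' : α < 1) {t t' : ℝ}
    (ht : t ∈ Icc a b) (ht' : t' ∈ Icc a b) (htt : t ≤ t') :
    ∫ s in Icc a b, (rlKernel α t' s - rlKernel α t s) ^ 2
      ≤ 2 * (t' - t) ^ (2 * α - 1) / (2 * α - 1) := by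
  have hp : 0 < 2 * α - 1 := by linarith
  have hsub : Icc t b ⊆ Icc a b := Icc_subset_Icc_left ht.1
  have hpt : ∀ s, (rlKernel α t' s - rlKernel α t s) ^ 2 ≤
      rlKernel (2 * α - 1) t s - rlKernel (2 * α - 1) t' s
        + 2 * (Ici t).indicator (rlKernel (2 * α - 1) t') s := by
    intro s
    rw [← rlKernel_sq, ← rlKernel_sq]
    by_cases h : s < t
    · have h1 : rlKernel α t' s ≤ rlKernel α t s := by
        simp only [rlKernel, if_pos h, if_pos (h.trans_le htt)]
        exact Real.rpow_le_rpow_of_nonpos (by linarith) (by linarith) (by linarith)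
      have h2 := rlKernel_nonneg α t' s
      rw [indicator_of_notMem (by simpa using h)]
      nlinarith
    · have h1 : rlKernel α t s = 0 := if_neg h
      rw [indicator_of_mem (by simpa using h), ← rlKernel_sq, h1]
      apply le_of_eq
      ring
  have hi1 := integrableOn_rlKernel hp ht
  have hi2 := integrableOn_rlKernel hp ht'
  have hi3 : IntegrableOn ((Ici t).indicator (rlKernel (2 * α - 1) t')) (Icc a b) :=
    hi2.integrable.indicator measurableSet_Ici
  have hi4 : ∫ s in Icc a b, (Ici t).indicator (rlKernel (2 * α - 1) t') s
      = (t' - t) ^ (2 * α - 1) / (2 * α - 1) := by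
    have : Icc a b ∩ Ici t = Icc t b := by
      ext s
      simp only [mem_inter_iff, mem_Icc, mem_Ici]
      exact ⟨fun h => ⟨h.2, h.1.2⟩, fun h => ⟨⟨ht.1.trans h.1, h.2⟩, h.1⟩⟩
    rw [setIntegral_indicator measurableSet_Ici, this, integral_rlKernel hp ⟨htt, ht'.2⟩]
  have hsq : Integrable (fun s => (rlKernel α t' s - rlKernel α t s) ^ 2)
      (volume.restrict (Icc a b)) :=
    ((memLp_rlKernel hα ht').sub (memLp_rlKernel hα ht)).integrable_sq
  calc ∫ s in Icc a b, (rlKernel α t' s - rlKernel α t s) ^ 2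
      ≤ ∫ s in Icc a b, (rlKernel (2 * α - 1) t s - rlKernel (2 * α - 1) t' s
        + 2 * (Ici t).indicator (rlKernel (2 * α - 1) t') s) :=
        integral_mono hsq ((hi1.sub hi2).add (hi3.const_mul 2)) hpt
    _ = (t - a) ^ (2 * α - 1) / (2 * α - 1) - (t' - a) ^ (2 * α - 1) / (2 * α - 1)
        + 2 * ((t' - t) ^ (2 * α - 1) / (2 * α - 1)) := by
        have hi5 : Integrable (fun s => rlKernel (2 * α - 1) t s - rlKernel (2 * α - 1) t' s)
          (volume.restrict (Icc a b)) := hi1.sub hi2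
        rw [integral_add hi5 (hi3.const_mul 2), integral_sub hi1 hi2,
          integral_rlKernel hp ht, integral_rlKernel hp ht', integral_const_mul, hi4]
    _ ≤ 2 * (t' - t) ^ (2 * α - 1) / (2 * α - 1) := by
        have : (t - a) ^ (2 * α - 1) / (2 * α - 1) ≤ (t' - a) ^ (2 * α - 1) / (2 * α - 1) := by
          gcongr
          linarith [ht.1]
        rw [mul_div_assoc]
        linarith

/-! ### The composition `I^β I^(1-β)` -/

/-- Euler's Beta integral `B(1 - β, β)`; the exponents sum to 1, so the power of `t - r` drops out
and `Γ(1) = 1`. -/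
theorem integral_beta {β : ℝ} (hβ : 0 < β) (hβ' : β < 1) {r t : ℝ} (hrt : r < t) :
    ∫ s in r..t, (t - s) ^ (β - 1) * (s - r) ^ ((1 - β) - 1)
      = Real.Gamma β * Real.Gamma (1 - β) := by
  have h1 : ∫ s in r..t, (t - s) ^ (β - 1) * (s - r) ^ ((1 - β) - 1)
      = ∫ x in (0 : ℝ)..(t - r), x ^ ((1 - β) - 1) * (t - r - x) ^ (β - 1) := by
    have := intervalIntegral.integral_comp_sub_right (a := r) (b := t)
      (fun x => x ^ ((1 - β) - 1) * (t - r - x) ^ (β - 1)) r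
    rw [sub_self] at this
    rw [← this]
    refine intervalIntegral.integral_congr fun s _ => ?_
    rw [mul_comm]
    congr 2
    ring
  rw [h1]
  have h2 := Complex.betaIntegral_scaled ((1 - β : ℝ) : ℂ) (β : ℂ) (sub_pos.2 hrt)
  have h3 : ((1 - β : ℝ) : ℂ) + β - 1 = 0 := by push_cast; ring
  have h4 := Complex.Gamma_mul_Gamma_eq_betaIntegral (s := ((1 - β : ℝ) : ℂ)) (t := (β : ℂ))
    (by rw [Complex.ofReal_re]; linarith) (by rwa [Complex.ofReal_re])
  have h5 : ((1 - β : ℝ) : ℂ) + β = 1 := by push_cast; ring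
  rw [h3, Complex.cpow_zero, one_mul] at h2
  rw [h5, Complex.Gamma_one, one_mul, ← h2, Complex.Gamma_ofReal, Complex.Gamma_ofReal] at h4
  apply Complex.ofReal_injective
  rw [mul_comm, Complex.ofReal_mul, h4, ← intervalIntegral.integral_ofReal]
  refine intervalIntegral.integral_congr fun x hx => ?_
  rw [uIcc_of_le (by linarith)] at hx
  rw [Complex.ofReal_mul, Complex.ofReal_cpow hx.1, Complex.ofReal_cpow (by linarith [hx.2])]
  push_cast
  rfl

theorem integral_rlKernel_mul {β : ℝ} (hβ : 0 < β) (hβ' : β < 1) {r t : ℝ}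
    (hr : r ∈ Icc a b) (ht : t ∈ Icc a b) :
    ∫ s in Icc a b, rlKernel β t s * rlKernel (1 - β) s r
      = if r < t then Real.Gamma β * Real.Gamma (1 - β) else 0 := by
  have h1 : (fun s => rlKernel β t s * rlKernel (1 - β) s r)
      = (Ioo r t).indicator fun s => (t - s) ^ (β - 1) * (s - r) ^ ((1 - β) - 1) := by
    ext s
    simp only [rlKernel, indicator_apply, mem_Ioo]
    split_ifs <;> simp_all
  have h2 : Icc a b ∩ Ioo r t = Ioo r t :=
    inter_eq_self_of_subset_right fun s hs => ⟨hr.1.trans hs.1.le, hs.2.le.trans ht.2⟩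
  rw [h1, setIntegral_indicator measurableSet_Ioo, h2]
  split_ifs with h
  · rw [← integral_beta hβ hβ' h, intervalIntegral.integral_of_le h.le,
      integral_Ioc_eq_integral_Ioo]
  · rw [Ioo_eq_empty h]
    simp

/-- The integral has already been evaluated as a positive number, whereas the integral of a
nonintegrable function is 0 by convention. -/
theorem integrableOn_rlKernel_mul {β : ℝ} (hβ : 0 < β) (hβ' : β < 1) {r t : ℝ}
    (hr : r ∈ Icc a b) (ht : t ∈ Icc a b) :
    IntegrableOn (fun s => rlKernel β t s * rlKernel (1 - β) s r) (Icc a b) := by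
  by_cases h : r < t
  · by_contra hni
    have h1 := integral_rlKernel_mul hβ hβ' hr ht
    rw [integral_undef hni, if_pos h] at h1
    exact (mul_pos (Real.Gamma_pos_of_pos hβ) (Real.Gamma_pos_of_pos (sub_pos.2 hβ'))).ne h1
  · have : (fun s => rlKernel β t s * rlKernel (1 - β) s r) = fun _ => 0 := by
      ext s
      unfold rlKernel
      split_ifs with h1 h2
      · exact absurd (h2.trans h1) h
      all_goals simp
    rw [this]
    exact integrableOn_zero

/-- The semigroup property `I^β I^(1-β) = I^1`. -/
theorem rlIntegral_rlIntegral {n : ℕ} {β : ℝ} (hβ : 0 < β) (hβ' : β < 1)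
    {f : ℝ → EuclideanSpace ℝ (Fin n)} (hf : IntegrableOn f (Icc a b)) {t : ℝ}
    (ht : t ∈ Icc a b) :
    rlIntegral a β (rlIntegral a (1 - β) f) t = ∫ r in a..t, f r := by
  set ν := volume.restrict (Icc a b) with hν
  have hG1 := Real.Gamma_pos_of_pos hβ
  have hG2 := Real.Gamma_pos_of_pos (sub_pos.2 hβ')
  have hmeas : AEStronglyMeasurable
      (fun p : ℝ × ℝ => (rlKernel β t p.1 * rlKernel (1 - β) p.1 p.2) • f p.2) (ν.prod ν) := by
    refine AEStronglyMeasurable.smul (f := fun p : ℝ × ℝ => rlKernel β t p.1 * rlKernel (1 - β) p.1 p.2)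
      ?_ hf.aestronglyMeasurable.comp_snd
    exact (((measurable_rlKernel β t).comp measurable_fst).mul
      (measurable_rlKernel_uncurry (1 - β))).aestronglyMeasurable
  have hint : Integrable
      (Function.uncurry fun s r => (rlKernel β t s * rlKernel (1 - β) s r) • f r)
      (ν.prod ν) := by
    refine (integrable_prod_iff' hmeas).2 ⟨?_, ?_⟩
    · refine (ae_restrict_mem measurableSet_Icc).mono fun r hr => ?_
      exact (integrableOn_rlKernel_mul hβ hβ' hr ht).integrable.smul_const (f r)
    · have h1 : (fun r => ∫ s, ‖(rlKernel β t s * rlKernel (1 - β) s r) • f r‖ ∂ν)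
          =ᵐ[ν] (Iio t).indicator fun r => (Real.Gamma β * Real.Gamma (1 - β)) * ‖f r‖ := by
        refine (ae_restrict_mem measurableSet_Icc).mono fun r hr => ?_
        simp only [norm_smul, Real.norm_of_nonneg (mul_nonneg (rlKernel_nonneg _ _ _)
          (rlKernel_nonneg _ _ _))]
        rw [integral_mul_const, integral_rlKernel_mul hβ hβ' hr ht]
        simp only [indicator_apply, mem_Iio]
        split_ifs <;> simp
      refine Integrable.congr ?_ h1.symm
      exact (hf.norm.const_mul _).indicator measurableSet_Iio
  have hswap := integral_integral_swap hint
  have hL : ∫ s, rlKernel β t s • rlIntegral a (1 - β) f s ∂ν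
      = (1 / Real.Gamma (1 - β)) • ∫ s, ∫ r, (rlKernel β t s * rlKernel (1 - β) s r) • f r ∂ν ∂ν := by
    rw [← integral_smul]
    refine integral_congr_ae ((ae_restrict_mem measurableSet_Icc).mono fun s hs => ?_)
    simp only
    rw [rlIntegral_eq (1 - β) hs, smul_comm, ← integral_smul]
    simp only [smul_smul]
    rfl
  have hR : ∫ r, ∫ s, (rlKernel β t s * rlKernel (1 - β) s r) • f r ∂ν ∂ν
      = (Real.Gamma β * Real.Gamma (1 - β)) • ∫ r in a..t, f r := by
    have h1 : (fun r => ∫ s, (rlKernel β t s * rlKernel (1 - β) s r) • f r ∂ν)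
        =ᵐ[ν] fun r => (Real.Gamma β * Real.Gamma (1 - β)) • rlKernel 1 t r • f r := by
      refine (ae_restrict_mem measurableSet_Icc).mono fun r hr => ?_
      simp only
      rw [integral_smul_const, integral_rlKernel_mul hβ hβ' hr ht]
      simp only [rlKernel]
      split_ifs <;> simp
    rw [integral_congr_ae h1, integral_smul, setIntegral_rlKernel 1 ht]
    simp
  rw [rlIntegral_eq β ht, hL, hswap, hR, smul_smul, smul_smul]
  rw [show 1 / Real.Gamma β * (1 / Real.Gamma (1 - β)) * (Real.Gamma β * Real.Gamma (1 - β)) = 1 by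
    field_simp, one_smul]

theorem rlIntegral_congr_ae {n : ℕ} (γ : ℝ) {u v : ℝ → EuclideanSpace ℝ (Fin n)}
    (h : u =ᵐ[volume.restrict (Icc a b)] v) {t : ℝ} (ht : t ∈ Icc a b) :
    rlIntegral a γ u t = rlIntegral a γ v t := by
  rw [rlIntegral_eq γ ht, rlIntegral_eq γ ht]
  congr 1
  refine integral_congr_ae (h.mono fun s hs => ?_)
  simp only [hs]

theorem ae_mem_Ioo : ∀ᵐ t ∂volume.restrict (Icc a b), t ∈ Ioo a b := by
  rw [Measure.restrict_congr_set Ioo_ae_eq_Icc.symm]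
  exact ae_restrict_mem measurableSet_Ioo

/-- The Riemann-Liouville derivative inverts the Riemann-Liouville integral. -/
theorem rlDeriv_ae_eq {n : ℕ} {α : ℝ} (hα : 0 < α) (hα' : α < 1)
    {f u : ℝ → EuclideanSpace ℝ (Fin n)} (hf : IntegrableOn f (Icc a b))
    (hu : u =ᵐ[volume.restrict (Icc a b)] rlIntegral a α f) :
    rlDeriv a α u =ᵐ[volume.restrict (Icc a b)] f := by
  rcases lt_or_ge b a with hab | hab
  · rw [Icc_eq_empty hab.not_ge, Measure.restrict_empty]
    exact ae_zero.symm ▸ eventually_bot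
  -- `I^(1-α) I^α f` is the primitive of `f`, so Lebesgue differentiation recovers `f` almost
  -- everywhere.
  have h1 : ∀ t ∈ Icc a b, rlIntegral a (1 - α) u t = ∫ r in a..t, f r := by
    intro t ht
    rw [rlIntegral_congr_ae (1 - α) hu ht]
    have := rlIntegral_rlIntegral (β := 1 - α) (by linarith) (by linarith) hf ht
    rwa [sub_sub_cancel] at this
  have h2 := IntervalIntegrable.ae_hasDerivAt_integral
    ((intervalIntegrable_iff_integrableOn_Icc_of_le hab).2 hf)
  filter_upwards [ae_restrict_of_ae (s := Icc a b) h2, ae_mem_Ioo] with t h3 ht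
  have h4 := h3 (by rw [uIcc_of_le hab]; exact Ioo_subset_Icc_self ht) a left_mem_uIcc
  refine (h4.congr_of_eventuallyEq ?_).deriv
  filter_upwards [Icc_mem_nhds ht.1 ht.2] with s hs using h1 s hs

/-- A bounded measurable function has a square integrable Riemann-Liouville integral. -/
theorem memLp_rlIntegral {n : ℕ} {γ : ℝ} (hγ : 0 < γ) {f : ℝ → EuclideanSpace ℝ (Fin n)}
    (hf : AEStronglyMeasurable f (volume.restrict (Icc a b))) {M : ℝ} (hM : ∀ s, ‖f s‖ ≤ M) :
    MemLp (rlIntegral a γ f) 2 (volume.restrict (Icc a b)) := by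
  set ν := volume.restrict (Icc a b) with hν
  have hG := Real.Gamma_pos_of_pos hγ
  have hM0 : 0 ≤ M := (norm_nonneg _).trans (hM 0)
  have hae : (fun t => (1 / Real.Gamma γ) • ∫ s, rlKernel γ t s • f s ∂ν)
      =ᵐ[ν] rlIntegral a γ f :=
    (ae_restrict_mem measurableSet_Icc).mono fun t ht => (rlIntegral_eq γ ht f).symm
  refine MemLp.ae_eq hae (MemLp.of_bound ?_ (1 / Real.Gamma γ * ((b - a) ^ γ / γ * M)) ?_)
  · have h1 : AEStronglyMeasurable (fun p : ℝ × ℝ => rlKernel γ p.1 p.2 • f p.2) (ν.prod ν) :=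
      (measurable_rlKernel_uncurry γ).aestronglyMeasurable.smul hf.comp_snd
    exact h1.integral_prod_right'.const_smul (1 / Real.Gamma γ)
  · refine (ae_restrict_mem measurableSet_Icc).mono fun t ht => ?_
    rw [norm_smul, Real.norm_of_nonneg (by positivity)]
    gcongr
    calc ‖∫ s, rlKernel γ t s • f s ∂ν‖ ≤ ∫ s, rlKernel γ t s * M ∂ν := by
          refine norm_integral_le_of_norm_le ((integrableOn_rlKernel hγ ht).integrable.mul_const M)
            (ae_of_all _ fun s => ?_)
          rw [norm_smul, Real.norm_of_nonneg (rlKernel_nonneg _ _ _)]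
          exact mul_le_mul_of_nonneg_left (hM s) (rlKernel_nonneg _ _ _)
      _ = (t - a) ^ γ / γ * M := by rw [integral_mul_const, integral_rlKernel hγ ht]
      _ ≤ (b - a) ^ γ / γ * M := by
          have := Real.rpow_le_rpow (by linarith [ht.1]) (sub_le_sub_right ht.2 a) hγ.le
          gcongr

/-- Test functions are Riemann-Liouville integrals of square integrable functions. -/
theorem IsTestFunction.exists_memLp {n : ℕ} {α : ℝ} (hα : 0 < α) (hα' : α < 1)
    {φ : ℝ → EuclideanSpace ℝ (Fin n)} (hφ : IsTestFunction a b φ) :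
    ∃ h : ℝ → EuclideanSpace ℝ (Fin n), MemLp h 2 (volume.restrict (Icc a b)) ∧
      ∀ t ∈ Icc a b, rlIntegral a α h t = φ t := by
  have hsupp : ∀ t, t ∉ Ioo a b → φ t = 0 := fun t ht =>
    image_eq_zero_of_notMem_tsupport fun h => ht (hφ.2 h)
  have hcs : HasCompactSupport φ := by
    refine HasCompactSupport.of_support_subset_isCompact (isCompact_Icc (a := a) (b := b)) ?_
    exact (subset_tsupport φ).trans (hφ.2.trans Ioo_subset_Icc_self)
  have hd : Continuous (deriv φ) := hφ.1.continuous_deriv (by simp)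
  obtain ⟨M, hM⟩ := hcs.deriv.exists_bound_of_continuous hd
  -- The Caputo derivative of `φ`: applying `I^α` gives the primitive of `φ'`, which is `φ` since `φ
  -- a = 0`.
  refine ⟨rlIntegral a (1 - α) (deriv φ),
    memLp_rlIntegral (by linarith) hd.aestronglyMeasurable hM, fun t ht => ?_⟩
  rw [rlIntegral_rlIntegral hα hα' (hd.continuousOn.integrableOn_Icc) ht,
    intervalIntegral.integral_deriv_eq_sub (fun x _ => (hφ.1.differentiable (by simp)) x)
      (hd.intervalIntegrable _ _), hsupp a (by simp), sub_zero]

end Interval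

/-! ### The fractional integral as a compact operator from L² to continuous functions. -/

section Operator

variable {n : ℕ} {a b α : ℝ}

/-- The modulus of continuity of Riemann-Liouville integrals of functions of unit `L²` norm. -/
def rlModulus (α d : ℝ) : ℝ :=
  1 / Real.Gamma α * √(2 * d ^ (2 * α - 1) / (2 * α - 1))

theorem tendsto_rlModulus (hα : 1 / 2 < α) : Tendsto (rlModulus α) (𝓝 0) (𝓝 0) := by
  have h : ContinuousAt (rlModulus α) 0 := by
    have : ContinuousAt (fun d : ℝ => d ^ (2 * α - 1)) 0 :=
      Real.continuousAt_rpow_const _ _ (Or.inr (by linarith))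
    unfold rlModulus
    fun_prop
  have h0 : rlModulus α 0 = 0 := by
    simp [rlModulus, Real.zero_rpow (show 2 * α - 1 ≠ 0 by linarith)]
  simpa [ContinuousAt, h0] using h

theorem integrable_rlKernel_smul (hα : 1 / 2 < α) {t : ℝ} (ht : t ∈ Icc a b)
    {g : ℝ → EuclideanSpace ℝ (Fin n)} (hg : MemLp g 2 (volume.restrict (Icc a b))) :
    Integrable (fun s => rlKernel α t s • g s) (volume.restrict (Icc a b)) :=
  memLp_one_iff_integrable.1 (hg.smul (memLp_rlKernel hα ht))

theorem rlIntegral_add (hα : 1 / 2 < α) {t : ℝ} (ht : t ∈ Icc a b)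
    {g h : ℝ → EuclideanSpace ℝ (Fin n)} (hg : MemLp g 2 (volume.restrict (Icc a b)))
    (hh : MemLp h 2 (volume.restrict (Icc a b))) :
    rlIntegral a α (g + h) t = rlIntegral a α g t + rlIntegral a α h t := by
  rw [rlIntegral_eq α ht, rlIntegral_eq α ht, rlIntegral_eq α ht, ← smul_add,
    ← integral_add (integrable_rlKernel_smul hα ht hg) (integrable_rlKernel_smul hα ht hh)]
  simp only [Pi.add_apply, smul_add]

theorem rlIntegral_smul (c : ℝ) {t : ℝ} (ht : t ∈ Icc a b)
    (g : ℝ → EuclideanSpace ℝ (Fin n)) :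
    rlIntegral a α (c • g) t = c • rlIntegral a α g t := by
  rw [rlIntegral_eq α ht, rlIntegral_eq α ht, smul_comm c, ← integral_smul c]
  congr 1
  refine integral_congr_ae (ae_of_all _ fun s => ?_)
  simp only [Pi.smul_apply]
  rw [smul_comm]

/-- Cauchy-Schwarz against the L² estimate for differences of kernels; this is Hölder continuity of
exponent `α - 1/2`. -/
theorem norm_rlIntegral_sub_le (hα : 1 / 2 < α) (hα' : α < 1)
    (g : Lp (EuclideanSpace ℝ (Fin n)) 2 (volume.restrict (Icc a b))) {t t' : ℝ}
    (ht : t ∈ Icc a b) (ht' : t' ∈ Icc a b) :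
    ‖rlIntegral a α g t - rlIntegral a α g t'‖ ≤ rlModulus α |t - t'| * ‖g‖ := by
  wlog h : t' ≤ t generalizing t t'
  · rw [norm_sub_rev, abs_sub_comm]
    exact this ht' ht (le_of_not_ge h)
  have hG := Real.Gamma_pos_of_pos (show 0 < α by linarith)
  have hg : MemLp g 2 (volume.restrict (Icc a b)) := Lp.memLp g
  have hk : MemLp (fun s => rlKernel α t s - rlKernel α t' s) 2 (volume.restrict (Icc a b)) :=
    (memLp_rlKernel hα ht).sub (memLp_rlKernel hα ht')
  have hhol := integral_mul_norm_le_Lp_mul_Lq (p := 2) (q := 2)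
    (f := fun s => rlKernel α t s - rlKernel α t' s) (g := fun s => ‖g s‖)
    Real.HolderConjugate.two_two
    (by rwa [ENNReal.ofReal_ofNat]) (by rw [ENNReal.ofReal_ofNat]; exact hg.norm)
  simp only [norm_norm] at hhol
  have hgn : (∫ s, ‖g s‖ ^ (2 : ℝ) ∂volume.restrict (Icc a b)) ^ (1 / 2 : ℝ) = ‖g‖ := by
    rw [← Real.sqrt_eq_rpow, ← Real.sqrt_sq (norm_nonneg g), ← real_inner_self_eq_norm_sq,
      L2.inner_def]
    congr 1
    refine integral_congr_ae (ae_of_all _ fun s => ?_)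
    simp
  have hkn : (∫ s, ‖rlKernel α t s - rlKernel α t' s‖ ^ (2 : ℝ) ∂volume.restrict (Icc a b)) ^ (1 / 2 : ℝ)
      ≤ √(2 * |t - t'| ^ (2 * α - 1) / (2 * α - 1)) := by
    rw [← Real.sqrt_eq_rpow, abs_of_nonneg (sub_nonneg.2 h)]
    refine Real.sqrt_le_sqrt ?_
    refine le_trans (le_of_eq ?_) (integral_sq_rlKernel_sub_le hα hα' ht' ht h)
    refine integral_congr_ae (ae_of_all _ fun s => ?_)
    simp
  rw [rlIntegral_eq α ht, rlIntegral_eq α ht', ← smul_sub, ← integral_sub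
    (integrable_rlKernel_smul hα ht hg) (integrable_rlKernel_smul hα ht' hg), norm_smul,
    Real.norm_of_nonneg (by positivity : (0 : ℝ) ≤ 1 / Real.Gamma α), rlModulus, mul_assoc]
  gcongr
  calc ‖∫ s in Icc a b, (rlKernel α t s • g s - rlKernel α t' s • g s)‖
      ≤ ∫ s in Icc a b, ‖rlKernel α t s • g s - rlKernel α t' s • g s‖ :=
        norm_integral_le_integral_norm _
    _ = ∫ s, ‖rlKernel α t s - rlKernel α t' s‖ * ‖g s‖ ∂volume.restrict (Icc a b) := by
        simp only [← sub_smul, norm_smul]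
    _ ≤ _ := hhol
    _ ≤ _ := by rw [hgn]; gcongr

theorem rlIntegral_left (γ : ℝ) (u : ℝ → EuclideanSpace ℝ (Fin n)) : rlIntegral a γ u a = 0 := by
  simp [rlIntegral]

theorem continuousOn_rlIntegral (hα : 1 / 2 < α) (hα' : α < 1)
    (g : Lp (EuclideanSpace ℝ (Fin n)) 2 (volume.restrict (Icc a b))) :
    ContinuousOn (rlIntegral a α g) (Icc a b) := by
  intro t ht
  rw [ContinuousWithinAt, tendsto_iff_norm_sub_tendsto_zero]
  have h1 : Tendsto (fun s => rlModulus α |s - t| * ‖g‖) (𝓝[Icc a b] t) (𝓝 0) := by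
    have h2 : Tendsto (fun s : ℝ => |s - t|) (𝓝[Icc a b] t) (𝓝 0) := by
      have : Continuous fun s : ℝ => |s - t| := by fun_prop
      simpa using (this.tendsto t).mono_left nhdsWithin_le_nhds
    simpa using ((tendsto_rlModulus hα).comp h2).mul_const ‖g‖
  refine squeeze_zero' (Eventually.of_forall fun s => norm_nonneg _) ?_ h1
  filter_upwards [self_mem_nhdsWithin] with s hs
  exact norm_rlIntegral_sub_le hα hα' g hs ht

/-- The Riemann-Liouville integral of order `α > 1/2` as a bounded operator from `L²` to the
continuous functions. -/
def rlOperator (n : ℕ) (a b : ℝ) (hα : 1 / 2 < α) (hα' : α < 1) :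
    Lp (EuclideanSpace ℝ (Fin n)) 2 (volume.restrict (Icc a b)) →L[ℝ]
      C(Icc a b, EuclideanSpace ℝ (Fin n)) :=
  LinearMap.mkContinuous
    { toFun := fun g => ⟨(Icc a b).domRestrict (rlIntegral a α g),
        (continuousOn_rlIntegral hα hα' g).domRestrict⟩
      map_add' := fun g h => by
        ext1 t
        change rlIntegral a α (g + h : Lp _ _ _) t = rlIntegral a α g t + rlIntegral a α h t
        rw [← rlIntegral_add hα t.2 (Lp.memLp g) (Lp.memLp h)]
        exact rlIntegral_congr_ae α (Lp.coeFn_add g h) t.2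
      map_smul' := fun c g => by
        ext1 t
        change rlIntegral a α (c • g : Lp _ _ _) t = c • rlIntegral a α g t
        rw [← rlIntegral_smul c t.2]
        exact rlIntegral_congr_ae α (Lp.coeFn_smul c g) t.2 }
    (1 / Real.Gamma α * √(2 * (b - a) ^ (2 * α - 1) / (2 * α - 1)))
    (fun g => by
      have hG := Real.Gamma_pos_of_pos (show 0 < α by linarith)
      refine (ContinuousMap.norm_le _ (by positivity)).2 fun t => ?_
      have hab : a ≤ b := t.2.1.trans t.2.2
      have h1 := norm_rlIntegral_sub_le hα hα' g t.2 (left_mem_Icc.2 hab)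
      rw [rlIntegral_left, sub_zero, abs_of_nonneg (sub_nonneg.2 t.2.1)] at h1
      refine h1.trans ?_
      unfold rlModulus
      have h2 : ((t : ℝ) - a) ^ (2 * α - 1) ≤ (b - a) ^ (2 * α - 1) :=
        Real.rpow_le_rpow (by linarith [t.2.1]) (by linarith [t.2.2]) (by linarith)
      have h3 : 0 < 2 * α - 1 := by linarith
      gcongr)

theorem rlOperator_apply (hα : 1 / 2 < α) (hα' : α < 1)
    (g : Lp (EuclideanSpace ℝ (Fin n)) 2 (volume.restrict (Icc a b))) (t : Icc a b) :
    rlOperator n a b hα hα' g t = rlIntegral a α g t := rfl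

/-- Arzelà-Ascoli: images of the unit ball are equibounded and share the modulus `rlModulus`. -/
theorem isCompactOperator_rlOperator (hα : 1 / 2 < α) (hα' : α < 1) :
    IsCompactOperator (rlOperator n a b hα hα') := by
  set K := rlOperator n a b hα hα' with hK
  change IsCompactOperator K.toLinearMap
  rw [isCompactOperator_iff_isCompact_closure_image_closedBall K.toLinearMap one_pos]
  set A := K.toLinearMap '' Metric.closedBall 0 1 with hA
  set e := (ContinuousMap.isometryEquivBoundedOfCompact (Icc a b)
    (EuclideanSpace ℝ (Fin n))).toHomeomorph with he
  have hb : ∀ g ∈ Metric.closedBall (0 : Lp (EuclideanSpace ℝ (Fin n)) 2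
      (volume.restrict (Icc a b))) 1, ‖g‖ ≤ 1 := fun g hg => by simpa using hg
  have h1 : IsCompact (closure (e '' A)) := by
    refine BoundedContinuousFunction.arzela_ascoli (Metric.closedBall 0 ‖K‖)
      (isCompact_closedBall _ _) _ ?_ ?_
    · rintro _ t ⟨_, ⟨g, hg, rfl⟩, rfl⟩
      rw [mem_closedBall_zero_iff]
      change ‖K g t‖ ≤ ‖K‖
      refine ((K g).norm_coe_le_norm t).trans ((K.le_opNorm g).trans ?_)
      exact mul_le_of_le_one_right (norm_nonneg _) (hb g hg)
    · refine Metric.equicontinuous_of_continuity_modulus (rlModulus α) (tendsto_rlModulus hα) _ ?_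
      rintro s t ⟨_, _, ⟨g, hg, rfl⟩, rfl⟩
      change dist (rlIntegral a α g s) (rlIntegral a α g t) ≤ _
      rw [dist_eq_norm, Subtype.dist_eq, Real.dist_eq]
      refine (norm_rlIntegral_sub_le hα hα' g s.2 t.2).trans ?_
      refine mul_le_of_le_one_right ?_ (hb g hg)
      have hG := Real.Gamma_pos_of_pos (show 0 < α by linarith)
      unfold rlModulus
      positivity
  rw [← e.image_closure] at h1
  exact e.isCompact_image.1 h1

theorem memLp_rlIntegral_of_memLp (hα : 1 / 2 < α) (hα' : α < 1)
    (g : Lp (EuclideanSpace ℝ (Fin n)) 2 (volume.restrict (Icc a b))) :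
    MemLp (rlIntegral a α g) 2 (volume.restrict (Icc a b)) := by
  have hc := continuousOn_rlIntegral hα hα' g
  obtain ⟨C, hC⟩ := isCompact_Icc.exists_bound_of_continuousOn hc
  exact MemLp.of_bound (hc.aestronglyMeasurable measurableSet_Icc) C
    ((ae_restrict_mem measurableSet_Icc).mono hC)

theorem integrableOn_of_memLp_two {Y : Type*} [NormedAddCommGroup Y] {g : ℝ → Y}
    (hg : MemLp g 2 (volume.restrict (Icc a b))) : IntegrableOn g (Icc a b) :=
  hg.integrable one_le_two

theorem injective_rlOperator (hα : 1 / 2 < α) (hα' : α < 1) :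
    Function.Injective (rlOperator n a b hα hα') := by
  refine (injective_iff_map_eq_zero _).2 fun g hg => ?_
  have hI : ∀ h : Lp (EuclideanSpace ℝ (Fin n)) 2 (volume.restrict (Icc a b)),
      IntegrableOn h (Icc a b) := fun h => integrableOn_of_memLp_two (Lp.memLp h)
  have h0 : rlIntegral a α g =ᵐ[volume.restrict (Icc a b)]
      rlIntegral a α (0 : ℝ → EuclideanSpace ℝ (Fin n)) := by
    refine (ae_restrict_mem measurableSet_Icc).mono fun t ht => ?_
    have := DFunLike.congr_fun hg ⟨t, ht⟩
    rw [rlOperator_apply] at this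
    simpa [rlIntegral] using this
  have h1 := rlDeriv_ae_eq (by linarith) hα' (hI g) (ae_eq_refl _)
  have h2 := rlDeriv_ae_eq (f := (0 : ℝ → EuclideanSpace ℝ (Fin n))) (by linarith) hα'
    integrableOn_zero h0
  exact (Lp.eq_zero_iff_ae_eq_zero).2 (h1.symm.trans h2)

/-! ### The fractional space as the image of a closed subspace of L². -/

/-- The square integrable functions whose Riemann-Liouville integral is a test function. -/
def testDerivs (n : ℕ) (a b : ℝ) (hα : 1 / 2 < α) (hα' : α < 1) :
    Submodule ℝ (Lp (EuclideanSpace ℝ (Fin n)) 2 (volume.restrict (Icc a b))) where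
  carrier := {g | ∃ φ, IsTestFunction a b φ ∧ ∀ t : Icc a b, rlOperator n a b hα hα' g t = φ t}
  add_mem' := by
    rintro g h ⟨φ, hφ, hg⟩ ⟨ψ, hψ, hh⟩
    refine ⟨φ + ψ, ⟨hφ.1.add hψ.1, ?_⟩, fun t => by simp [hg, hh]⟩
    exact (tsupport_add φ ψ).trans (union_subset hφ.2 hψ.2)
  zero_mem' := ⟨0, ⟨contDiff_const, by simp [tsupport]⟩, fun t => by simp⟩
  smul_mem' := by
    rintro c g ⟨φ, hφ, hg⟩
    refine ⟨c • φ, ⟨contDiff_const.smul hφ.1, ?_⟩, fun t => by simp [hg]⟩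
    exact (closure_mono (Function.support_const_smul_subset c φ)).trans hφ.2

theorem IsTestFunction.exists_mem_testDerivs (hα : 1 / 2 < α) (hα' : α < 1)
    {φ : ℝ → EuclideanSpace ℝ (Fin n)} (hφ : IsTestFunction a b φ) :
    ∃ g ∈ testDerivs n a b hα hα', (∀ t : Icc a b, rlOperator n a b hα hα' g t = φ t) ∧
      rlDeriv a α φ =ᵐ[volume.restrict (Icc a b)] g := by
  obtain ⟨h, hh, hφh⟩ := hφ.exists_memLp (α := α) (by linarith) hα'
  have h1 : ∀ t : Icc a b, rlOperator n a b hα hα' hh.toLp t = φ t := fun t => by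
    rw [rlOperator_apply, rlIntegral_congr_ae α hh.coeFn_toLp t.2, hφh t t.2]
  refine ⟨hh.toLp, ⟨φ, hφ, h1⟩, h1, ?_⟩
  refine rlDeriv_ae_eq (by linarith) hα' (integrableOn_of_memLp_two (Lp.memLp _)) ?_
  exact (ae_restrict_mem measurableSet_Icc).mono fun t ht => (h1 ⟨t, ht⟩).symm

/-- A bump function at the midpoint times a coordinate vector supplies the nonzero direction needed
for the mountain pass. -/
theorem testDerivs_ne_bot (hn : 1 ≤ n) (hab : a < b) (hα : 1 / 2 < α) (hα' : α < 1) :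
    testDerivs n a b hα hα' ≠ ⊥ := by
  have hm : (a + b) / 2 ∈ Ioo a b := ⟨by linarith, by linarith⟩
  obtain ⟨f, hf1, -, hf2, -, hf3⟩ := exists_contDiff_tsupport_subset (n := (⊤ : ℕ∞))
    (isOpen_Ioo.mem_nhds hm)
  set v : EuclideanSpace ℝ (Fin n) := EuclideanSpace.single ⟨0, hn⟩ 1 with hv
  have hv0 : v ≠ 0 := by
    rw [← norm_ne_zero_iff]
    simp [hv]
  have hφ : IsTestFunction a b fun t => f t • v := by
    refine ⟨hf2.smul contDiff_const, (closure_mono ?_).trans hf1⟩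
    exact Function.support_smul_subset_left f _
  obtain ⟨g, hg, hgφ, -⟩ := hφ.exists_mem_testDerivs hα hα'
  refine (Submodule.ne_bot_iff _).2 ⟨g, hg, fun h0 => hv0 ?_⟩
  have := hgφ ⟨_, Ioo_subset_Icc_self hm⟩
  simpa [h0, hf3] using this.symm

theorem tendsto_eLpNorm_sub_rlOperator (hα : 1 / 2 < α) (hα' : α < 1) {ι : Type*} {l : Filter ι}
    {g : ι → Lp (EuclideanSpace ℝ (Fin n)) 2 (volume.restrict (Icc a b))}
    {z : Lp (EuclideanSpace ℝ (Fin n)) 2 (volume.restrict (Icc a b))} (hg : Tendsto g l (𝓝 z)) :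
    Tendsto (fun k => eLpNorm (fun t => rlIntegral a α (g k) t - rlIntegral a α z t) 2
      (volume.restrict (Icc a b))) l (𝓝 0) := by
  set K := rlOperator n a b hα hα' with hK
  have h1 : Tendsto (fun k => ‖K (g k) - K z‖) l (𝓝 0) :=
    tendsto_iff_norm_sub_tendsto_zero.1 ((K.continuous.tendsto z).comp hg)
  have h2 : Tendsto (fun k => volume.restrict (Icc a b) univ ^ (2 : ℝ≥0∞).toReal⁻¹ *
      ENNReal.ofReal ‖K (g k) - K z‖) l (𝓝 0) := by
    have := ENNReal.Tendsto.const_mul (a := volume.restrict (Icc a b) univ ^ (2 : ℝ≥0∞).toReal⁻¹)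
      (ENNReal.tendsto_ofReal h1) (Or.inr (by simp))
    simpa using this
  refine tendsto_of_tendsto_of_tendsto_of_le_of_le tendsto_const_nhds h2 (fun _ => zero_le)
    fun k => ?_
  refine eLpNorm_le_of_ae_bound ((ae_restrict_mem measurableSet_Icc).mono fun t ht => ?_)
  exact (K (g k) - K z).norm_coe_le_norm ⟨t, ht⟩

/-- Elements of the closure of the derivatives of test functions give elements of the fractional
space. -/
theorem memE0_rlIntegral (hα : 1 / 2 < α) (hα' : α < 1)
    {z : Lp (EuclideanSpace ℝ (Fin n)) 2 (volume.restrict (Icc a b))}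
    (hz : z ∈ (testDerivs n a b hα hα').topologicalClosure) :
    MemE0 a b α (rlIntegral a α z) ∧
      rlDeriv a α (rlIntegral a α z) =ᵐ[volume.restrict (Icc a b)] z ∧
      (a < b → rlIntegral a α z b = 0) := by
  have hD := rlDeriv_ae_eq (u := rlIntegral a α z) (α := α) (by linarith) hα'
    (integrableOn_of_memLp_two (Lp.memLp z)) (ae_eq_refl _)
  obtain ⟨g, hg, hlim⟩ := mem_closure_iff_seq_limit.1 hz
  choose φ hφ hgφ using hg
  have hφD : ∀ k, rlDeriv a α (φ k) =ᵐ[volume.restrict (Icc a b)] g k := fun k =>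
    rlDeriv_ae_eq (by linarith) hα' (integrableOn_of_memLp_two (Lp.memLp _))
      ((ae_restrict_mem measurableSet_Icc).mono fun t ht => (hgφ k ⟨t, ht⟩).symm)
  refine ⟨⟨?_, (memLp_congr_ae hD).2 (Lp.memLp z), φ, hφ, ?_, ?_⟩, hD, fun hab => ?_⟩
  · exact memLp_rlIntegral_of_memLp hα hα' z
  · refine (tendsto_eLpNorm_sub_rlOperator hα hα' hlim).congr fun k => ?_
    refine eLpNorm_congr_ae ((ae_restrict_mem measurableSet_Icc).mono fun t ht => ?_)
    simp only
    rw [← hgφ k ⟨t, ht⟩]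
    rfl
  · have h1 := (Lp.tendsto_Lp_iff_tendsto_eLpNorm' g z).1 hlim
    refine h1.congr fun k => eLpNorm_congr_ae ?_
    filter_upwards [hφD k, hD] with t h2 h3
    simp [h2, h3]
  -- Evaluation at `b` is continuous for the sup norm, so the boundary value of the test functions
  -- survives in the limit.
  · have hbI : b ∈ Icc a b := right_mem_Icc.2 hab.le
    have h1 : Tendsto (fun k => rlOperator n a b hα hα' (g k) ⟨b, hbI⟩) atTop
        (𝓝 (rlOperator n a b hα hα' z ⟨b, hbI⟩)) :=
      ((continuous_eval_const (⟨b, hbI⟩ : Icc a b)).tendsto _).comp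
        (((rlOperator n a b hα hα').continuous.tendsto z).comp hlim)
    refine tendsto_nhds_unique h1 (tendsto_const_nhds.congr fun k => ?_)
    rw [hgφ k]
    exact (image_eq_zero_of_notMem_tsupport fun h => lt_irrefl b ((hφ k).2 h).2).symm

/-- Elements of the fractional space are Riemann-Liouville integrals of elements of the closure of
the derivatives of test functions. -/
theorem MemE0.exists_rlOperator (hα : 1 / 2 < α) (hα' : α < 1)
    {v : ℝ → EuclideanSpace ℝ (Fin n)} (hv : MemE0 a b α v) :
    ∃ h ∈ (testDerivs n a b hα hα').topologicalClosure,
      rlDeriv a α v =ᵐ[volume.restrict (Icc a b)] h ∧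
      v =ᵐ[volume.restrict (Icc a b)] rlIntegral a α h := by
  obtain ⟨hv1, hv2, φ, hφ, hφv, hφD⟩ := hv
  choose g hgS hgφ hgD using fun k => (hφ k).exists_mem_testDerivs hα hα'
  have hlim : Tendsto g atTop (𝓝 hv2.toLp) := by
    rw [Lp.tendsto_Lp_iff_tendsto_eLpNorm']
    refine hφD.congr fun k => eLpNorm_congr_ae ?_
    filter_upwards [hgD k, hv2.coeFn_toLp] with t h1 h2
    simp [h1, h2]
  refine ⟨hv2.toLp, mem_closure_of_tendsto hlim (Eventually.of_forall hgS),
    hv2.coeFn_toLp.symm, ?_⟩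
  have hI : MemLp (rlIntegral a α hv2.toLp) 2 (volume.restrict (Icc a b)) :=
    memLp_rlIntegral_of_memLp hα hα' _
  have hgI : ∀ k, MemLp (rlIntegral a α (g k)) 2 (volume.restrict (Icc a b)) := fun k =>
    memLp_rlIntegral_of_memLp hα hα' _
  have h1 := tendsto_eLpNorm_sub_rlOperator hα hα' hlim
  have h2 : Tendsto (fun k => eLpNorm (fun t => rlIntegral a α (g k) t - v t) 2
      (volume.restrict (Icc a b))) atTop (𝓝 0) := by
    refine hφv.congr fun k => eLpNorm_congr_ae ?_
    refine (ae_restrict_mem measurableSet_Icc).mono fun t ht => ?_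
    simp only
    rw [← hgφ k ⟨t, ht⟩]
    rfl
  -- The test functions `φ k` converge in L² both to `v` and to the fractional integral of the limit
  -- of their derivatives.
  have h3 : eLpNorm (fun t => v t - rlIntegral a α hv2.toLp t) 2
      (volume.restrict (Icc a b)) = 0 := by
    refine le_antisymm (ge_of_tendsto' (by simpa using h1.add h2) fun k => ?_) (zero_le)
    have h4 : (fun t => v t - rlIntegral a α hv2.toLp t) =
        (fun t => rlIntegral a α (g k) t - rlIntegral a α hv2.toLp t)
          - fun t => rlIntegral a α (g k) t - v t := by
      ext1 t
      simp
    rw [h4]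
    exact eLpNorm_sub_le ((hgI k).sub hI).1 ((hgI k).sub hv1).1 one_le_two
  have h5 := (eLpNorm_eq_zero_iff (hv1.sub hI).1 two_ne_zero).1 h3
  exact h5.mono fun t ht => sub_eq_zero.1 ht

end Operator

/-! ### The measure on the interval, and regularity of the nonlinearity. -/

/-- Lebesgue measure on a compact interval, as a type. -/
def iccMeasure (a b : ℝ) : Measure (Icc a b) := Measure.comap Subtype.val volume

instance (a b : ℝ) : IsFiniteMeasure (iccMeasure a b) := by
  refine ⟨?_⟩
  rw [iccMeasure, (MeasurableEmbedding.subtype_coe measurableSet_Icc).comap_apply volume,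
    image_univ, Subtype.range_coe]
  exact measure_Icc_lt_top

theorem isOpenPosMeasure_iccMeasure {a b : ℝ} (hab : a < b) :
    (iccMeasure a b).IsOpenPosMeasure := by
  refine ⟨fun U hU ⟨x, hx⟩ => ?_⟩
  obtain ⟨V, hV, rfl⟩ := isOpen_induced_iff.1 hU
  have h1 : (x : ℝ) ∈ closure (Ioo a b) := by
    rw [closure_Ioo hab.ne]
    exact x.2
  have h2 : (V ∩ Ioo a b).Nonempty := mem_closure_iff.1 h1 V hV hx
  have h3 := (hV.inter isOpen_Ioo).measure_pos volume h2
  have h4 : V ∩ Ioo a b ⊆ V ∩ Icc a b := inter_subset_inter_right _ Ioo_subset_Icc_self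
  have h5 : iccMeasure a b ((Subtype.val : Icc a b → ℝ) ⁻¹' V) = volume (V ∩ Icc a b) := by
    rw [iccMeasure, (MeasurableEmbedding.subtype_coe measurableSet_Icc).comap_apply volume,
      Subtype.image_preimage_coe, inter_comm]
  rw [h5]
  exact (h3.trans_le (measure_mono h4)).ne'

section Gradient

variable {E : Type*} [NormedAddCommGroup E] [InnerProductSpace ℝ E] [CompleteSpace E] {a b : ℝ}
  {W : ℝ → E → ℝ}

/-- At an endpoint `t` the strip is not a neighbourhood of `(t, x)`, but the slice `{t} × E` lies
wholly in it, so the derivative within the strip restricts to a full derivative in `x`. -/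
theorem hasFDerivAt_slice
    (hW : ContDiffOn ℝ 1 (fun p : ℝ × E => W p.1 p.2) (Icc a b ×ˢ univ)) {t : ℝ}
    (ht : t ∈ Icc a b) (x : E) :
    HasFDerivAt (W t) ((fderivWithin ℝ (fun p : ℝ × E => W p.1 p.2) (Icc a b ×ˢ univ) (t, x)).comp
      (ContinuousLinearMap.inr ℝ ℝ E)) x := by
  have h1 := ((hW.differentiableOn one_ne_zero) (t, x) ⟨ht, mem_univ x⟩).hasFDerivWithinAt
  have h2 : HasFDerivAt (fun y : E => (t, y)) (ContinuousLinearMap.inr ℝ ℝ E) x :=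
    hasFDerivAt_prodMk_right t x
  have h3 := h1.comp x (h2.hasFDerivWithinAt (s := univ)) fun y _ => ⟨ht, mem_univ y⟩
  exact hasFDerivWithinAt_univ.1 h3

theorem hasFDerivAt_innerSL_gradient
    (hW : ContDiffOn ℝ 1 (fun p : ℝ × E => W p.1 p.2) (Icc a b ×ˢ univ)) {t : ℝ}
    (ht : t ∈ Icc a b) (x : E) : HasFDerivAt (W t) (innerSL ℝ (gradient (W t) x)) x :=
  (hasFDerivAt_slice hW ht x).differentiableAt.hasGradientAt.hasFDerivAt

theorem continuous_gradient (hab : a < b)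
    (hW : ContDiffOn ℝ 1 (fun p : ℝ × E => W p.1 p.2) (Icc a b ×ˢ univ)) :
    Continuous (Function.uncurry fun (t : Icc a b) (x : E) => gradient (W t) x) := by
  have hs : UniqueDiffOn ℝ (Icc a b ×ˢ (univ : Set E)) :=
    (uniqueDiffOn_Icc hab).prod uniqueDiffOn_univ
  have h1 := hW.continuousOn_fderivWithin hs le_rfl
  have h2 : Continuous fun p : Icc a b × E =>
      fderivWithin ℝ (fun p : ℝ × E => W p.1 p.2) (Icc a b ×ˢ univ) ((p.1 : ℝ), p.2) :=
    h1.comp_continuous (by fun_prop) fun p => ⟨p.1.2, mem_univ _⟩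
  have h3 : (Function.uncurry fun (t : Icc a b) (x : E) => gradient (W t) x)
      = fun p : Icc a b × E => (InnerProductSpace.toDual ℝ E).symm
        ((fderivWithin ℝ (fun p : ℝ × E => W p.1 p.2) (Icc a b ×ˢ univ) ((p.1 : ℝ), p.2)).comp
          (ContinuousLinearMap.inr ℝ ℝ E)) := by
    ext1 p
    simp only [Function.uncurry, gradient]
    rw [(hasFDerivAt_slice hW p.1.2 p.2).fderiv]
  rw [h3]
  exact (InnerProductSpace.toDual ℝ E).symm.continuous.comp (h2.clm_comp continuous_const)

/-- A nonnegative function vanishing at the origin, with gradient `o(|x|)`, is `o(|x|²)`. -/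
theorem le_mul_sq_of_gradient_le {f : E → ℝ} {G : E → E}
    (hf : ∀ x, HasFDerivAt f (innerSL ℝ (G x)) x) (h0 : f 0 = 0) (hf0 : ∀ x, 0 ≤ f x) {ε δ : ℝ}
    (hG : ∀ x, 0 < ‖x‖ → ‖x‖ < δ → ‖G x‖ ≤ ε * ‖x‖) (hε : 0 ≤ ε) {x : E} (hx : ‖x‖ < δ) :
    f x ≤ ε * ‖x‖ ^ 2 := by
  have hmin : IsLocalMin f 0 := Eventually.of_forall fun y => by rw [h0]; exact hf0 y
  -- The bound on `G` excludes the origin; there the gradient vanishes because 0 is a minimum.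
  have hG0 : innerSL ℝ (G 0) = 0 := hmin.hasFDerivAt_eq_zero (hf 0)
  have h1 := (convex_closedBall (0 : E) ‖x‖).norm_image_sub_le_of_norm_hasFDerivWithin_le
    (f := f) (f' := fun y => innerSL ℝ (G y)) (C := ε * ‖x‖)
    (fun y _ => (hf y).hasFDerivWithinAt) (fun y hy => by
      rw [mem_closedBall_zero_iff] at hy
      rcases eq_or_ne y 0 with rfl | hy0
      · rw [hG0, norm_zero]
        positivity
      · rw [innerSL_apply_norm]
        exact (hG y (norm_pos_iff.2 hy0) (hy.trans_lt hx)).trans (by gcongr))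
    (Metric.mem_closedBall_self (norm_nonneg x)) (y := x) (by simp)
  rw [h0, sub_zero, sub_zero] at h1
  calc f x ≤ ε * ‖x‖ * ‖x‖ := (le_abs_self _).trans h1
    _ = ε * ‖x‖ ^ 2 := by ring

end Gradient

theorem le_one_add_rpow {y σ : ℝ} (hy : 0 ≤ y) (hσ : 1 ≤ σ) : y ≤ 1 + y ^ σ := by
  rcases le_total y 1 with h | h
  · linarith [Real.rpow_nonneg hy σ]
  · linarith [Real.self_le_rpow_of_one_le h hσ]

end FracBVP

end

/-! ### Verification of the abstract hypotheses and return to the boundary value problem. -/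

open FracBVP

theorem theorem4p1 (n : ℕ) (hn : 1 ≤ n) (α : ℝ) (hα : 1 / 2 < α) (hα' : α < 1)
    (ϱ : ℝ) (hϱ : 0 < ϱ) (W : ℝ → EuclideanSpace ℝ (Fin n) → ℝ)
    (hW : ContDiffOn ℝ 1 (fun p : ℝ × EuclideanSpace ℝ (Fin n) => W p.1 p.2)
      (Icc (-ϱ) ϱ ×ˢ univ))
    (hW₁ : ∀ ε > 0, ∃ δ > 0, ∀ t ∈ Icc (-ϱ) ϱ, ∀ x : EuclideanSpace ℝ (Fin n),
      0 < ‖x‖ → ‖x‖ < δ → ‖gradient (W t) x‖ ≤ ε * ‖x‖)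
    (hW₂ : ∀ t ∈ Icc (-ϱ) ϱ, ∀ x : EuclideanSpace ℝ (Fin n),
      0 ≤ W t x ∧ 0 ≤ FracBVP.H W t x)
    (hW₃ : ∀ M : ℝ, ∃ r > 0, ∀ t ∈ Icc (-ϱ) ϱ, ∀ x : EuclideanSpace ℝ (Fin n),
      r ≤ ‖x‖ → M ≤ W t x / ‖x‖ ^ 2)
    (hW₄ : ∃ C₀ R σ : ℝ, 0 < C₀ ∧ 0 < R ∧ 1 < σ ∧
      ∀ t ∈ Icc (-ϱ) ϱ, ∀ x : EuclideanSpace ℝ (Fin n), R ≤ ‖x‖ →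
        ‖gradient (W t) x‖ ^ σ / ‖x‖ ^ σ ≤ C₀ * FracBVP.H W t x) :
    ∃ u : ℝ → EuclideanSpace ℝ (Fin n),
      FracBVP.IsWeakSolution (-ϱ) ϱ α W u ∧ ∃ t ∈ Ioo (-ϱ) ϱ, u t ≠ 0 := by
  have hab : -ϱ < ϱ := by linarith
  obtain ⟨C₀, R, σ, hC₀, hR, hσ, hW₄⟩ := hW₄
  have hpos := isOpenPosMeasure_iccMeasure hab
  have htop : Fact ((2 : ℝ≥0∞) ≠ ⊤) := ⟨ENNReal.ofNat_ne_top⟩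
  have hgrad : ∀ (t : Icc (-ϱ) ϱ) (x : EuclideanSpace ℝ (Fin n)),
      HasFDerivAt (W t) (innerSL ℝ (gradient (W t) x)) x := fun t x => hasFDerivAt_innerSL_gradient hW t.2 x
  have hF := continuous_gradient hab hW
  have hWc : Continuous (Function.uncurry
      fun (t : Icc (-ϱ) ϱ) (x : EuclideanSpace ℝ (Fin n)) => W t x) :=
    hW.continuousOn.comp_continuous (f := fun p : Icc (-ϱ) ϱ × EuclideanSpace ℝ (Fin n) =>
      ((p.1 : ℝ), p.2)) (by fun_prop) fun p => ⟨p.1.2, mem_univ _⟩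
  -- `H(t, 0) = -W(t, 0)`, so the two sign conditions force equality.
  have hW0 : ∀ t : Icc (-ϱ) ϱ, W t 0 = 0 := fun t => by
    have h := hW₂ t t.2 0
    have h2 := h.2
    simp only [H, inner_zero_right] at h2
    linarith [h.1]
  obtain ⟨z, hz, hz0, hcrit⟩ := exists_nontrivial_critical (iccMeasure (-ϱ) ϱ)
    (rlOperator n (-ϱ) ϱ hα hα') (isCompactOperator_rlOperator hα hα')
    (injective_rlOperator hα hα') hWc hF hgrad (fun t x => (hW₂ t t.2 x).1)
    (fun t x => (hW₂ t t.2 x).2)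
    (fun ε hε => by
      obtain ⟨δ, hδ, h⟩ := hW₁ ε hε
      exact ⟨δ, hδ, fun t x hx => le_mul_sq_of_gradient_le (hgrad t) (hW0 t)
        (fun y => (hW₂ t t.2 y).1) (h t t.2) (le_of_lt hε) hx⟩)
    (fun M => by
      obtain ⟨r, hr, h⟩ := hW₃ M
      exact ⟨r, hr, fun t x hx => (le_div_iff₀ (pow_pos (hr.trans_le hx) 2)).1 (h t t.2 x hx)⟩)
    hC₀.le (R := R)
    (fun t x hx => by
      have h1 := hW₄ t t.2 x hx
      have hx0 : 0 < ‖x‖ := hR.trans_le hx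
      rw [← Real.div_rpow (norm_nonneg _) (norm_nonneg _)] at h1
      -- With `y = ‖∇W‖ / ‖x‖`, the bound `y ≤ 1 + y ^ σ ≤ 1 + C₀ H` is the growth condition used by
      -- the a priori estimate.
      have h2 := le_one_add_rpow (y := ‖gradient (W t) x‖ / ‖x‖) (by positivity) hσ.le
      rw [← div_le_iff₀ hx0]
      exact h2.trans (add_le_add_right h1 1))
    (testDerivs n (-ϱ) ϱ hα hα') (testDerivs_ne_bot hn hab hα hα')
  obtain ⟨huE, huD, hub⟩ := memE0_rlIntegral hα hα' hz
  set u := rlIntegral (-ϱ) α z with hu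
  have huc : ContinuousOn u (Icc (-ϱ) ϱ) := continuousOn_rlIntegral hα hα' z
  refine ⟨u, ⟨huE, huc, rlIntegral_left α z, hub hab, fun v hv => ?_⟩, ?_⟩
  · obtain ⟨h, hh, hvD, hvh⟩ := hv.exists_rlOperator hα hα'
    have h1 : (fun t => inner ℝ (rlDeriv (-ϱ) α u t) (rlDeriv (-ϱ) α v t))
        =ᵐ[volume.restrict (Icc (-ϱ) ϱ)] fun t => inner ℝ (z t) (h t) := by
      filter_upwards [huD, hvD] with t h2 h3
      rw [h2, h3]
    have h2 : (fun t => inner ℝ (gradient (W t) (u t)) (v t))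
        =ᵐ[volume.restrict (Icc (-ϱ) ϱ)]
          fun t => inner ℝ (gradient (W t) (u t)) (rlIntegral (-ϱ) α h t) := by
      filter_upwards [hvh] with t h3
      rw [h3]
    have h3 : ContinuousOn (fun t => inner ℝ (gradient (W t) (u t)) (rlIntegral (-ϱ) α h t))
        (Icc (-ϱ) ϱ) := by
      rw [continuousOn_iff_continuous_domRestrict]
      exact (superposition hF (rlOperator n (-ϱ) ϱ hα hα' z)).continuous.inner
        (rlOperator n (-ϱ) ϱ hα hα' h).continuous
    refine ⟨(L2.integrable_inner z h).congr h1.symm, h3.integrableOn_Icc.congr h2.symm, ?_⟩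
    rw [integral_congr_ae h1, integral_congr_ae h2, ← L2.inner_def, hcrit h hh]
    exact integral_subtype_comap measurableSet_Icc
      fun t => inner ℝ (gradient (W t) (u t)) (rlIntegral (-ϱ) α h t)
  · by_contra! h0
    refine hz0 (injective_rlOperator hα hα' ?_)
    ext1 t
    rw [map_zero, rlOperator_apply]
    rcases eq_endpoints_or_mem_Ioo_of_mem_Icc t.2 with h | h | h
    · rw [h]
      exact rlIntegral_left α z
    · rw [h]
      exact hub hab
    · exact h0 t h
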